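/- **Theorem (Maxwell's equations power balance, Stokes–Lagrange case).** Let $\Omega\subset\mathbb R^3$ be a bounded open set with Lipschitz boundary, with surface measure $\mathrm ds$ and outer unit normal $\boldsymbol n$ (defined $\mathrm ds$-a.e. on $\partial\Omega$), and let $\varepsilon_0,\mu_0>0$. For vector fields $\boldsymbol D,\boldsymbol A$ on $\Omega$ put $$H(\boldsymbol D,\boldsymbol A)=\frac12\int_\Omega \frac1{\mu_0}|\mathbf{curl}\,\boldsymbol A|^2+\frac1{\varepsilon_0}|\boldsymbol D|^2\,\mathrm dx .$$ Let $I\subset\mathbb R$ be an open set of times and let $\boldsymbol A\in C^2(I\times\overline\Omega;\mathbb R^3)$, $\boldsymbol D\in C^1(I\times\overline\Omega;\mathbb R^3)$ be a classical solution, with current density $\boldsymbol J$, of Maxwell's equations in vector-potential form $$\partial_t\boldsymbol D=\delta_{\boldsymbol A}H-\boldsymbol J,\qquad \partial_t\boldsymbol A=-\boldsymbol E,\qquad \boldsymbol E=\delta_{\boldsymbol D}H\qquad\text{in } I\times\Omega ,$$ where $\delta_{\boldsymbol D}H,\delta_{\boldsymbol A}H$ are the variational derivatives of $H$ at $(\boldsymbol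 D,\boldsymbol A)$, i.e. the locally integrable fields $g$ on $\Omega$ for which the derivative at $h=0$ of $H$ along the variation $h\boldsymbol\varphi$ of the variable concerned is $\int_\Omega g\cdot\boldsymbol\varphi\,\mathrm dx$ for all $\boldsymbol\varphi\in C_c^\infty(\Omega;\mathbb R^3)$. Then $t\mapsto H(\boldsymbol D(t),\boldsymbol A(t))$ is differentiable on $I$, the integrals below converge, and for all $t\in I$ $$\frac{\mathrm d}{\mathrm dt}H=\int_{\partial\Omega}\Bigl(\partial_t\boldsymbol A\times\frac1{\mu_0}\mathbf{curl}\,\boldsymbol A\Bigr)\cdot\boldsymbol n\,\mathrm ds-\int_\Omega\boldsymbol J\cdot\boldsymbol E\,\mathrm dx .$$ The boundary term is the power of an energy port: it equals $\int_{\partial\Omega}\bigl(\frac1{\mu_0}\mathbf{curl}\,\boldsymbol A\times\boldsymbol n\bigr)\cdot\partial_t\boldsymbol A\,\mathrm ds$, the pairing of $\frac1{\mu_0}\mathbf{curl}\,\boldsymbol A\times\boldsymbol n$ with the time derivative of the boundary trace of $\boldsymbol A$. -/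

import Mathlib

open MeasureTheory Set Filter Topology
open scoped ContDiff

/-- Euclidean three-space. -/
abbrev E3 : Type := EuclideanSpace ℝ (Fin 3)

/-- The cross product of two vectors of Euclidean three-space. -/
noncomputable def cross3 (u v : E3) : E3 :=
  !₂[u 1 * v 2 - u 2 * v 1, u 2 * v 0 - u 0 * v 2, u 0 * v 1 - u 1 * v 0]

/-- The partial derivative `∂ⱼ Fᵢ (x)` relative to the set `s`. At an interior point of `s` it is
the ordinary partial derivative; at a boundary point of the closure of a Lipschitz domain it is
the value given by the one-sided differential, i.e. the limit from inside for `C¹` fields. -/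
noncomputable def partialWithin (s : Set E3) (F : E3 → E3) (j i : Fin 3) (x : E3) : ℝ :=
  (fderivWithin ℝ F s x (EuclideanSpace.single j 1)) i

/-- The curl of a vector field, relative to the set `s`. -/
noncomputable def curlWithin (s : Set E3) (F : E3 → E3) (x : E3) : E3 :=
  !₂[partialWithin s F 1 2 x - partialWithin s F 2 1 x,
     partialWithin s F 2 0 x - partialWithin s F 0 2 x,
     partialWithin s F 0 1 x - partialWithin s F 1 0 x]

/-- `Ω` has a Lipschitz boundary: near each boundary point, in suitable orthonormal coordinates,
`Ω` is the region lying strictly above the graph of a Lipschitz function of the first two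
coordinates. -/
def HasLipschitzBoundary (Ω : Set E3) : Prop :=
  ∀ x ∈ frontier Ω, ∃ (Φ : E3 ≃ₗᵢ[ℝ] E3) (K : NNReal) (g : EuclideanSpace ℝ (Fin 2) → ℝ)
    (U : Set E3), LipschitzWith K g ∧ IsOpen U ∧ x ∈ U ∧
      ∀ y ∈ U, (y ∈ Ω ↔ g !₂[Φ y 0, Φ y 1] < Φ y 2)

/-- `ν` is the outer unit normal to `Ω` at `x`: to first order at `x`, the set `Ω` is the half-space
`{y | ⟨y - x, ν⟩ < 0}`. -/
def IsOuterUnitNormal (Ω : Set E3) (x ν : E3) : Prop :=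
  ‖ν‖ = 1 ∧ ∀ δ > 0, ∀ᶠ y in 𝓝 x,
    (y ∈ Ω → inner ℝ (y - x) ν ≤ δ * ‖y - x‖) ∧
    (y ∉ Ω → -(δ * ‖y - x‖) ≤ inner ℝ (y - x) ν)

/-- The outer unit normal is unique where it exists. -/
theorem IsOuterUnitNormal.unique {Ω : Set E3} {x ν ν' : E3}
    (h : IsOuterUnitNormal Ω x ν) (h' : IsOuterUnitNormal Ω x ν') : ν = ν' := by
  by_contra hne
  obtain ⟨hn, h⟩ := h
  obtain ⟨hn', h'⟩ := h'
  set c : ℝ := inner ℝ ν ν' with hc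
  have hc1 : c < 1 := by
    have := (inner_lt_one_iff_real_of_norm_eq_one (x := ν) (y := ν') hn hn').2 hne
    simpa [hc] using this
  have hvv : ‖ν' - ν‖ ≤ 2 := by
    calc ‖ν' - ν‖ ≤ ‖ν'‖ + ‖ν‖ := norm_sub_le _ _
      _ = 2 := by rw [hn, hn']; norm_num
  have hδ : (0 : ℝ) < (1 - c) / 4 := by linarith
  have hcont : Tendsto (fun s : ℝ => x + s • (ν' - ν)) (𝓝[>] 0) (𝓝 x) := by
    have h0 : ContinuousAt (fun s : ℝ => x + s • (ν' - ν)) 0 := by fun_prop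
    have h1 : Tendsto (fun s : ℝ => x + s • (ν' - ν)) (𝓝 0) (𝓝 x) := by
      simpa [ContinuousAt] using h0
    exact h1.mono_left nhdsWithin_le_nhds
  obtain ⟨s, ⟨h1, h2⟩, hs⟩ := (((hcont.eventually (h _ hδ)).and
    (hcont.eventually (h' _ hδ))).and self_mem_nhdsWithin).exists
  have hs : (0 : ℝ) < s := hs
  have e1 : inner ℝ (x + s • (ν' - ν) - x) ν = s * (c - 1) := by
    rw [add_sub_cancel_left, inner_smul_left, inner_sub_left, real_inner_self_eq_norm_sq, hn,
      real_inner_comm]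
    simp [hc]
  have e2 : inner ℝ (x + s • (ν' - ν) - x) ν' = s * (1 - c) := by
    rw [add_sub_cancel_left, inner_smul_left, inner_sub_left, real_inner_self_eq_norm_sq, hn']
    simp [hc]
  have e3 : ‖x + s • (ν' - ν) - x‖ ≤ s * 2 := by
    rw [add_sub_cancel_left, norm_smul, Real.norm_of_nonneg hs.le]
    exact mul_le_mul_of_nonneg_left hvv hs.le
  have e4 : (1 - c) / 4 * ‖x + s • (ν' - ν) - x‖ ≤ (1 - c) / 4 * (s * 2) :=
    mul_le_mul_of_nonneg_left e3 hδ.le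
  have hpos : 0 < s * (1 - c) := mul_pos hs (by linarith)
  by_cases hy : x + s • (ν' - ν) ∈ Ω
  · have := h2.1 hy
    rw [e2] at this
    nlinarith
  · have := h1.2 hy
    rw [e1] at this
    nlinarith

open Classical in
/-- The outer unit normal field of `Ω` (and `0` where no outer unit normal exists). -/
noncomputable def outerNormal (Ω : Set E3) (x : E3) : E3 :=
  if h : ∃ ν, IsOuterUnitNormal Ω x ν then h.choose else 0

/-- The surface measure of `∂Ω`: two-dimensional Hausdorff measure, normalised so as to agree with
area, restricted to `∂Ω`. -/
noncomputable def surfaceMeasure (Ω : Set E3) : Measure E3 :=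
  (Measure.euclideanHausdorffMeasure 2).restrict (frontier Ω)

/-- The electromagnetic energy density `½ (|curl A|² / μ₀ + |D|² / ε₀)`. -/
noncomputable def emEnergyDensity (Ω : Set E3) (ε₀ μ₀ : ℝ) (D A : E3 → E3) (x : E3) : ℝ :=
  (1 / 2) * ((1 / μ₀) * ‖curlWithin (closure Ω) A x‖ ^ 2 + (1 / ε₀) * ‖D x‖ ^ 2)

/-- The electromagnetic Hamiltonian `½ ∫_Ω |curl A|² / μ₀ + |D|² / ε₀`. -/
noncomputable def emHamiltonian (Ω : Set E3) (ε₀ μ₀ : ℝ) (D A : E3 → E3) : ℝ :=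
  ∫ x in Ω, emEnergyDensity Ω ε₀ μ₀ D A x

/-- The locally integrable field `g` is the variational derivative on `Ω` of the functional `𝓕` at
the field `u`: for all smooth test fields `φ` with compact support in `Ω`,
`d/dh 𝓕 (u + h φ) = ∫_Ω g · φ` at `h = 0`. It is determined almost everywhere on `Ω`. -/
def IsVariationalDerivative (Ω : Set E3) (𝓕 : (E3 → E3) → ℝ) (u g : E3 → E3) : Prop :=
  LocallyIntegrableOn g Ω volume ∧
    ∀ φ : E3 → E3, ContDiff ℝ ∞ φ → HasCompactSupport φ → tsupport φ ⊆ Ω →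
      HasDerivAt (fun h : ℝ => 𝓕 (u + h • φ)) (∫ x in Ω, inner ℝ (g x) (φ x)) 0

/-- `(D, A)` is a classical solution, regular up to the boundary, on the time set `I`, of
Maxwell's equations in vector-potential form with current density `J`:
`∂ₜ D = δ_A H - J` and `∂ₜ A = - E`, where `E = δ_D H` and `eA = δ_A H` are the variational
derivatives of the Hamiltonian. -/
structure IsVectorPotentialSolution (Ω : Set E3) (ε₀ μ₀ : ℝ) (I : Set ℝ)
    (D A J E eA : ℝ → E3 → E3) : Prop where
  contDiffOn_A : ContDiffOn ℝ 2 (fun p : ℝ × E3 => A p.1 p.2) (I ×ˢ closure Ω)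
  contDiffOn_D : ContDiffOn ℝ 1 (fun p : ℝ × E3 => D p.1 p.2) (I ×ˢ closure Ω)
  effort_D : ∀ t ∈ I,
    IsVariationalDerivative Ω (fun D' => emHamiltonian Ω ε₀ μ₀ D' (A t)) (D t) (E t)
  effort_A : ∀ t ∈ I,
    IsVariationalDerivative Ω (fun A' => emHamiltonian Ω ε₀ μ₀ (D t) A') (A t) (eA t)
  deriv_D : ∀ t ∈ I, ∀ᵐ x ∂(volume.restrict Ω), deriv (fun s => D s x) t = eA t x - J t x
  deriv_A : ∀ t ∈ I, ∀ᵐ x ∂(volume.restrict Ω), deriv (fun s => A s x) t = - E t x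

/-! ### The area formula for Lipschitz expanding maps -/

section Area

open Module

set_option linter.unusedSectionVars false

variable {U V : Type*} [NormedAddCommGroup U] [InnerProductSpace ℝ U] [FiniteDimensional ℝ U]
  [MeasurableSpace U] [BorelSpace U]
  [NormedAddCommGroup V] [InnerProductSpace ℝ V] [FiniteDimensional ℝ V]
  [MeasurableSpace V] [BorelSpace V]

/-! Write `a = ∂ₜA` and `B = (1/μ₀) curl A`. The power balance is the integral of a pointwise
identity. Symmetry of second derivatives lets `∂ₜ` pass through the curl, so the energy density
changes at the rate `B · curl a + (1/ε₀) D · ∂ₜD` (`fderivWithin_curlWithin_slice`). Varying against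
compactly supported fields identifies the efforts almost everywhere: `E = D/ε₀` and `δ_A H = curl B`
(`ae_eq_effort_D`, `ae_eq_effort_A`). Since `div (a × B) = B · curl a - a · curl B`
(`divergence_cross3`), the field equations turn this rate into `div (a × B) - J · E`. The divergence
theorem for the `C¹` field `a × B` finishes the proof, and the second form of the boundary term is
the cyclic symmetry of the triple product.

Most of the work is the divergence theorem on a bounded Lipschitz domain with Hausdorff surface
measure (`HasLipschitzBoundary.hasDivergenceTheorem`). A partition of unity leaves fields supported
inside the domain, which have no flux, and fields supported in a chart where the domain lies above a
Lipschitz graph. There the field is cut off by a ramp in the height above the graph. Integration by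
parts puts the derivative on the ramp and gives a flux through the layer of heights between `ε` and
`2ε`; as `ε → 0` it becomes a plane integral against the unnormalised normal `N = (∇g, -1)`
(`setIntegral_divergence_graph`).

Two facts make that a surface integral: `|N|` is the area density of the graph, by the area formula
(`comap_euclideanHausdorffMeasure_eq_withDensity`), and `N / |N|` is the outer normal wherever `g`
is differentiable, hence almost everywhere by Rademacher. The area formula reduces to linear maps by
cutting the domain into pieces on which the map is nearly linear. -/

theorem euclideanHausdorffMeasure_image_le_of_lipschitzOnWith {X Y : Type*}
    [MetricSpace X] [MeasurableSpace X] [BorelSpace X]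
    [MetricSpace Y] [MeasurableSpace Y] [BorelSpace Y] {f : X → Y} {K : NNReal} {s : Set X}
    (hf : LipschitzOnWith K f s) (n : ℕ) :
    μHE[n] (f '' s) ≤ (K : ENNReal) ^ n * μHE[n] s := by
  have h := hf.hausdorffMeasure_image_le (d := n) (by positivity)
  simp only [Measure.euclideanHausdorffMeasure_def, Measure.smul_apply, ENNReal.smul_def,
    smul_eq_mul]
  rw [mul_left_comm]
  refine mul_le_mul_right ?_ _
  simpa using h

/-- If increments of `f` on `s` are at most `c` times those of `h`, the same holds for measures of
images up to the factor `c ^ n`. -/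
theorem euclideanHausdorffMeasure_image_le_of_norm_sub_le {X V : Type*}
    [NormedAddCommGroup V] [MeasurableSpace V] [BorelSpace V] {f h : X → V} {s : Set X}
    {c : NNReal} (n : ℕ) (hfh : ∀ x ∈ s, ∀ y ∈ s, ‖f x - f y‖ ≤ c * ‖h x - h y‖) :
    μHE[n] (f '' s) ≤ (c : ENNReal) ^ n * μHE[n] (h '' s) := by
  rcases s.eq_empty_or_nonempty with rfl | ⟨x₀, hx₀⟩
  · simp
  have : Nonempty X := ⟨x₀⟩
  choose! k hk using fun (y : V) (hy : y ∈ h '' s) => hy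
  have hL : LipschitzOnWith c (f ∘ k) (h '' s) := by
    refine LipschitzOnWith.of_dist_le_mul fun y hy z hz => ?_
    rw [dist_eq_norm, dist_eq_norm]
    have := hfh (k y) (hk y hy).1 (k z) (hk z hz).1
    rwa [(hk y hy).2, (hk z hz).2] at this
  have himg : f '' s ⊆ (f ∘ k) '' (h '' s) := by
    rintro _ ⟨x, hx, rfl⟩
    refine ⟨h x, mem_image_of_mem h hx, ?_⟩
    have hk' := hk (h x) (mem_image_of_mem h hx)
    have := hfh (k (h x)) hk'.1 x hx
    rw [hk'.2, sub_self, norm_zero, mul_zero] at this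
    exact sub_eq_zero.1 (norm_le_zero_iff.1 this)
  exact (measure_mono himg).trans (euclideanHausdorffMeasure_image_le_of_lipschitzOnWith hL n)

/-- Because `A` is expanding, the additive error `δ‖v‖` is at most `δ‖A v‖`. This turns closeness of
maps into multiplicative factors throughout the area formula. -/
theorem norm_le_mul_norm_of_norm_sub_le {U V : Type*} [NormedAddCommGroup U] [NormedSpace ℝ U]
    [NormedAddCommGroup V] [NormedSpace ℝ V] {A B : U →L[ℝ] V} {δ : NNReal} (hA : ∀ v, ‖v‖ ≤ ‖A v‖)
    (hAB : ‖B - A‖ ≤ δ) (v : U) : ‖B v‖ ≤ (1 + δ : NNReal) * ‖A v‖ := by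
  have h1 : ‖(B - A) v‖ ≤ δ * ‖v‖ := (B - A).le_of_opNorm_le hAB v
  have h2 : ‖B v‖ ≤ ‖A v‖ + ‖(B - A) v‖ := by
    have := norm_add_le (A v) ((B - A) v)
    simpa using this
  have h3 : (δ : ℝ) * ‖v‖ ≤ δ * ‖A v‖ := by gcongr; exact hA v
  push_cast
  linarith

/-- No linear algebra is needed: compare the Hausdorff measures of the two images of the unit ball,
then divide by the volume of the ball. -/
theorem normDet_le_of_norm_le {A B : U →L[ℝ] V} {c : NNReal} (h : ∀ v, ‖B v‖ ≤ c * ‖A v‖) :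
    ENNReal.ofReal B.toLinearMap.normDet
      ≤ (c : ENNReal) ^ finrank ℝ U * ENNReal.ofReal A.toLinearMap.normDet := by
  have key := euclideanHausdorffMeasure_image_le_of_norm_sub_le (f := B) (h := A)
    (s := Metric.closedBall (0 : U) 1) (c := c) (finrank ℝ U)
    (fun x _ y _ => by simpa using h (x - y))
  have e1 := B.toLinearMap.euclideanHausdorffMeasure_image_eq_normDet_mul_volume
    (Metric.closedBall (0 : U) 1)
  have e2 := A.toLinearMap.euclideanHausdorffMeasure_image_eq_normDet_mul_volume
    (Metric.closedBall (0 : U) 1)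
  simp only [ContinuousLinearMap.coe_coe] at e1 e2
  rw [e1, e2, ← mul_assoc] at key
  exact (ENNReal.mul_le_mul_iff_left (Metric.measure_closedBall_pos volume _ one_pos).ne'
    measure_closedBall_lt_top.ne).1 key

theorem HasFDerivAt.norm_le_of_expanding {U V : Type*} [NormedAddCommGroup U] [NormedSpace ℝ U]
    [NormedAddCommGroup V] [NormedSpace ℝ V] {f : U → V} {f' : U →L[ℝ] V} {x : U}
    (hf : HasFDerivAt f f' x) (h : ∀ x y, ‖x - y‖ ≤ ‖f x - f y‖) (v : U) : ‖v‖ ≤ ‖f' v‖ := by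
  have h1 := (hf.hasLineDerivAt v).tendsto_slope_zero
  refine ge_of_tendsto h1.norm ?_
  filter_upwards [self_mem_nhdsWithin] with t ht
  have ht : t ≠ 0 := ht
  rw [norm_smul, norm_inv]
  have := h (x + t • v) x
  rw [add_sub_cancel_left, norm_smul] at this
  rw [le_inv_mul_iff₀ (by positivity)]
  exact this

/-- The set of differentiability of `f` is cut into countably many measurable pieces on which `f`
and its derivative are `δ`-close to a single linear map. -/
theorem exists_partition_norm_fderiv_sub_le (f : U → V) {D : Set U}
    (hD : ∀ x ∈ D, DifferentiableAt ℝ f x) {δ : NNReal} (hδ : 0 < δ) :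
    ∃ P : ℕ × ℕ → Set U, Pairwise (Function.onFun Disjoint P) ∧ (∀ i, MeasurableSet (P i)) ∧
      D ⊆ ⋃ i, P i ∧ ∀ i, (D ∩ P i).Nonempty → ∃ y ∈ D,
        ApproximatesLinearOn f (fderiv ℝ f y) (D ∩ P i) δ ∧
        ∀ x ∈ D ∩ P i, ‖fderiv ℝ f x - fderiv ℝ f y‖ ≤ δ := by
  obtain ⟨d, hd⟩ := TopologicalSpace.exists_dense_seq (U →L[ℝ] V)
  -- Separability of the space of linear maps gives countably many pieces; radius `δ / 2` keeps any
  -- two derivatives taken in one piece within `δ`.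
  let B : ℕ → Set U := disjointed fun k => fderiv ℝ f ⁻¹' Metric.ball (d k) (δ / 2)
  have hBm : ∀ k, MeasurableSet (B k) := MeasurableSet.disjointed fun k =>
    measurable_fderiv ℝ f measurableSet_ball
  have hBd : Pairwise (Function.onFun Disjoint B) := disjoint_disjointed _
  have hBsub : ∀ k, B k ⊆ fderiv ℝ f ⁻¹' Metric.ball (d k) (δ / 2) := disjointed_subset _
  have hBU : ⋃ k, B k = univ := by
    rw [iUnion_disjointed, eq_univ_iff_forall]
    intro x
    obtain ⟨k, hk⟩ := hd.exists_dist_lt (fderiv ℝ f x) (show (0 : ℝ) < δ / 2 by positivity)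
    exact mem_iUnion.2 ⟨k, hk⟩
  have key := fun k => exists_partition_approximatesLinearOn_of_hasFDerivWithinAt f (D ∩ B k)
    (fderiv ℝ f) (fun x hx => (hD x hx.1).hasFDerivAt.hasFDerivWithinAt) (fun _ => δ)
    (fun _ => hδ.ne')
  choose t A htd htm htc hta htA using key
  refine ⟨fun i => B i.1 ∩ t i.1 i.2, ?_, fun i => (hBm _).inter (htm _ _), ?_, ?_⟩
  · rintro ⟨k, n⟩ ⟨k', n'⟩ hne
    by_cases hk : k = k'
    · subst hk
      have hn : n ≠ n' := fun h => hne (by rw [h])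
      exact (htd k hn).mono inter_subset_right inter_subset_right
    · exact (hBd hk).mono inter_subset_left inter_subset_left
  · intro x hx
    obtain ⟨k, hk⟩ := mem_iUnion.1 (hBU.symm ▸ mem_univ x : x ∈ ⋃ k, B k)
    obtain ⟨n, hn⟩ := mem_iUnion.1 (htc k ⟨hx, hk⟩)
    exact mem_iUnion.2 ⟨(k, n), hk, hn⟩
  · rintro ⟨k, n⟩ ⟨x₀, hx₀⟩
    obtain ⟨y, hy, hAy⟩ := htA k ⟨x₀, hx₀.1, hx₀.2.1⟩ n
    refine ⟨y, hy.1, ?_, fun x hx => ?_⟩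
    · rw [← hAy]
      refine (hta k n).mono_set ?_
      exact fun x hx => ⟨⟨hx.1, hx.2.1⟩, hx.2.2⟩
    · have h1 : dist (fderiv ℝ f x) (d k) < δ / 2 := hBsub k hx.2.1
      have h2 : dist (fderiv ℝ f y) (d k) < δ / 2 := hBsub k hy.2
      rw [← dist_eq_norm]
      linarith [dist_triangle_right (fderiv ℝ f x) (fderiv ℝ f y) (d k)]

/-- `normDet` is the square root of `det (B* B)`, hence continuous in `B`. -/
theorem measurable_normDet_fderiv (f : U → V) :
    Measurable fun x => ENNReal.ofReal (fderiv ℝ f x).toLinearMap.normDet := by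
  have h : Measurable fun x =>
      √((fderiv ℝ f x).adjoint ∘L (fderiv ℝ f x)).det := by
    have hc : Continuous fun B : U →L[ℝ] V => √(B.adjoint ∘L B).det := by
      have h1 : Continuous fun B : U →L[ℝ] V => B.adjoint ∘L B :=
        ContinuousLinearMap.adjoint.continuous.clm_comp continuous_id
      exact (ContinuousLinearMap.continuous_det.comp h1).sqrt
    exact hc.measurable.comp (measurable_fderiv ℝ f)
  refine ENNReal.measurable_ofReal.comp ?_
  convert! h using 2 with x
  rw [← ContinuousLinearMap.normDet_sq]
  simp [Real.sqrt_sq (LinearMap.normDet_nonneg _)]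

section Estimates

variable {f : U → V} {s : Set U} {A : U →L[ℝ] V} {δ : NNReal}

/-- The factor `(1 + δ) ^ n` is paid twice: once to replace `f` by `A` on `s`, and once to replace
the Jacobian of `A` by that of `f`. The linear case lies between the two. -/
theorem euclideanHausdorffMeasure_image_le_lintegral_of_approximatesLinearOn
    (hA : ∀ v, ‖v‖ ≤ ‖A v‖) (hfA : ApproximatesLinearOn f A s δ)
    (hf' : ∀ x ∈ s, ∀ v, ‖v‖ ≤ ‖fderiv ℝ f x v‖) (hA' : ∀ x ∈ s, ‖fderiv ℝ f x - A‖ ≤ δ) :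
    μHE[finrank ℝ U] (f '' s) ≤ ((1 + δ : NNReal) : ENNReal) ^ (2 * finrank ℝ U) *
      ∫⁻ x in s, ENNReal.ofReal (fderiv ℝ f x).toLinearMap.normDet := by
  have h1 : μHE[finrank ℝ U] (f '' s) ≤
      ((1 + δ : NNReal) : ENNReal) ^ finrank ℝ U * μHE[finrank ℝ U] (A '' s) := by
    refine euclideanHausdorffMeasure_image_le_of_norm_sub_le _ fun x hx y hy => ?_
    have e1 := hfA x hx y hy
    have e2 := norm_sub_norm_le (f x - f y) (A (x - y))
    have e3 : (δ : ℝ) * ‖x - y‖ ≤ δ * ‖A (x - y)‖ := by gcongr; exact hA _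
    rw [← map_sub]
    push_cast
    linarith
  have h2 : μHE[finrank ℝ U] (A '' s) = ENNReal.ofReal A.toLinearMap.normDet * volume s :=
    A.toLinearMap.euclideanHausdorffMeasure_image_eq_normDet_mul_volume s
  have h3 : ENNReal.ofReal A.toLinearMap.normDet * volume s ≤
      ((1 + δ : NNReal) : ENNReal) ^ finrank ℝ U *
        ∫⁻ x in s, ENNReal.ofReal (fderiv ℝ f x).toLinearMap.normDet := by
    rw [← lintegral_const_mul _ (measurable_normDet_fderiv f), ← setLIntegral_const]
    refine setLIntegral_mono ((measurable_normDet_fderiv f).const_mul _) fun x hx => ?_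
    refine normDet_le_of_norm_le fun v => norm_le_mul_norm_of_norm_sub_le (hf' x hx) ?_ v
    rw [norm_sub_rev]
    exact hA' x hx
  rw [h2] at h1
  rw [two_mul, pow_add, mul_assoc]
  exact h1.trans (mul_le_mul_right h3 _)

/-- The same comparison reversed. Expansion of `f` itself is now what bounds the increments of `A`
by those of `f`. -/
theorem lintegral_le_euclideanHausdorffMeasure_image_of_approximatesLinearOn
    (hA : ∀ v, ‖v‖ ≤ ‖A v‖) (hf : ∀ x y, ‖x - y‖ ≤ ‖f x - f y‖)
    (hfA : ApproximatesLinearOn f A s δ) (hA' : ∀ x ∈ s, ‖fderiv ℝ f x - A‖ ≤ δ) :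
    ∫⁻ x in s, ENNReal.ofReal (fderiv ℝ f x).toLinearMap.normDet ≤
      ((1 + δ : NNReal) : ENNReal) ^ (2 * finrank ℝ U) * μHE[finrank ℝ U] (f '' s) := by
  have h1 : μHE[finrank ℝ U] (A '' s) ≤
      ((1 + δ : NNReal) : ENNReal) ^ finrank ℝ U * μHE[finrank ℝ U] (f '' s) := by
    refine euclideanHausdorffMeasure_image_le_of_norm_sub_le _ fun x hx y hy => ?_
    have e1 := hfA x hx y hy
    have e2 := norm_sub_norm_le (A (x - y)) (f x - f y)
    rw [norm_sub_rev (A _)] at e2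
    have e3 : (δ : ℝ) * ‖x - y‖ ≤ δ * ‖f x - f y‖ := by gcongr; exact hf _ _
    rw [← map_sub]
    push_cast
    linarith
  have h2 : μHE[finrank ℝ U] (A '' s) = ENNReal.ofReal A.toLinearMap.normDet * volume s :=
    A.toLinearMap.euclideanHausdorffMeasure_image_eq_normDet_mul_volume s
  have h3 : ∫⁻ x in s, ENNReal.ofReal (fderiv ℝ f x).toLinearMap.normDet ≤
      ((1 + δ : NNReal) : ENNReal) ^ finrank ℝ U *
        (ENNReal.ofReal A.toLinearMap.normDet * volume s) := by
    rw [← mul_assoc, ← setLIntegral_const]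
    refine setLIntegral_mono measurable_const fun x hx => ?_
    exact normDet_le_of_norm_le fun v => norm_le_mul_norm_of_norm_sub_le hA (hA' x hx) v
  rw [← h2] at h3
  rw [two_mul, pow_add, mul_assoc]
  exact h3.trans (mul_le_mul_right h1 _)

end Estimates

theorem measurableEmbedding_of_expanding {f : U → V} {K : NNReal} (hK : LipschitzWith K f)
    (hf : ∀ x y, ‖x - y‖ ≤ ‖f x - f y‖) : MeasurableEmbedding f := by
  have h : AntilipschitzWith 1 f := AntilipschitzWith.of_le_mul_dist fun x y => by
    simpa [dist_eq_norm] using hf x y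
  exact (h.isClosedEmbedding hK.uniformContinuous).measurableEmbedding

/-- **Area formula** for Lipschitz expanding maps. -/
theorem comap_euclideanHausdorffMeasure_eq_withDensity {f : U → V} {K : NNReal}
    (hK : LipschitzWith K f) (hf : ∀ x y, ‖x - y‖ ≤ ‖f x - f y‖) :
    (μHE[finrank ℝ U] : Measure V).comap f =
      volume.withDensity fun x => ENNReal.ofReal (fderiv ℝ f x).toLinearMap.normDet := by
  have hemb := measurableEmbedding_of_expanding hK hf
  set ν₁ := (μHE[finrank ℝ U] : Measure V).comap f
  set ν₂ := (volume : Measure U).withDensity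
    fun x => ENNReal.ofReal (fderiv ℝ f x).toLinearMap.normDet with hν₂
  have hν₁ : ∀ s, ν₁ s = μHE[finrank ℝ U] (f '' s) := fun s => hemb.comap_apply _ s
  set D := {x | DifferentiableAt ℝ f x}
  have hDm : MeasurableSet D := measurableSet_of_differentiableAt ℝ f
  have hD0 : volume Dᶜ = 0 := hK.ae_differentiableAt
  -- The exceptional set of Rademacher's theorem is null for both measures, since a Lipschitz map
  -- sends null sets to null sets.
  have hν₁0 : ν₁ Dᶜ = 0 := by
    have h := euclideanHausdorffMeasure_image_le_of_lipschitzOnWith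
      (hK.lipschitzOnWith (s := Dᶜ)) (finrank ℝ U)
    rw [InnerProductSpace.euclideanHausdorffMeasure_eq_volume, hD0, mul_zero] at h
    rw [hν₁]
    exact le_antisymm h bot_le
  have hν₂0 : ν₂ Dᶜ = 0 := withDensity_absolutelyContinuous _ _ hD0
  have hexp : ∀ x ∈ D, ∀ v, ‖v‖ ≤ ‖fderiv ℝ f x v‖ := fun x hx v =>
    (DifferentiableAt.hasFDerivAt hx).norm_le_of_expanding hf v
  -- The pieces depend on `δ`, but the estimates sum over them with a common factor, which tends to
  -- 1 as `δ → 0`.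
  have key : ∀ s, MeasurableSet s → s ⊆ D → ∀ δ : NNReal, 0 < δ →
      ν₁ s ≤ ((1 + δ : NNReal) : ENNReal) ^ (2 * finrank ℝ U) * ν₂ s ∧
      ν₂ s ≤ ((1 + δ : NNReal) : ENNReal) ^ (2 * finrank ℝ U) * ν₁ s := by
    intro s hs hsD δ hδ
    obtain ⟨P, hPd, hPm, hPc, hP⟩ := exists_partition_norm_fderiv_sub_le f (D := s)
      (fun x hx => hsD hx) hδ
    have hdec : ∀ ν : Measure U, ν s = ∑' i, ν (s ∩ P i) := by
      intro ν
      rw [← measure_iUnion (fun i j hij => (hPd hij).mono inter_subset_right inter_subset_right)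
        (fun i => hs.inter (hPm i)), ← inter_iUnion, inter_eq_left.2 hPc]
    rw [hdec ν₁, hdec ν₂, ← ENNReal.tsum_mul_left, ← ENNReal.tsum_mul_left]
    have hpiece : ∀ i,
        ν₁ (s ∩ P i) ≤ ((1 + δ : NNReal) : ENNReal) ^ (2 * finrank ℝ U) * ν₂ (s ∩ P i) ∧
        ν₂ (s ∩ P i) ≤ ((1 + δ : NNReal) : ENNReal) ^ (2 * finrank ℝ U) * ν₁ (s ∩ P i) := by
      intro i
      rcases (s ∩ P i).eq_empty_or_nonempty with he | hne
      · simp [he]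
      obtain ⟨y, hy, hyA, hyd⟩ := hP i hne
      have hm := hs.inter (hPm i)
      rw [hν₁, hν₂, withDensity_apply _ hm]
      exact ⟨euclideanHausdorffMeasure_image_le_lintegral_of_approximatesLinearOn
          (hexp y (hsD hy)) hyA (fun x hx => hexp x (hsD hx.1)) hyd,
        lintegral_le_euclideanHausdorffMeasure_image_of_approximatesLinearOn
          (hexp y (hsD hy)) hf hyA hyd⟩
    exact ⟨ENNReal.tsum_le_tsum fun i => (hpiece i).1, ENNReal.tsum_le_tsum fun i => (hpiece i).2⟩
  have hlim : ∀ a : ENNReal, Tendsto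
      (fun δ : NNReal => ((1 + δ : NNReal) : ENNReal) ^ (2 * finrank ℝ U) * a) (𝓝[>] 0) (𝓝 a) := by
    intro a
    have h1 : Tendsto (fun δ : NNReal => ((1 + δ : NNReal) : ENNReal) ^ (2 * finrank ℝ U))
        (𝓝[>] 0) (𝓝 1) := by
      have hc : Continuous fun δ : NNReal => (1 + δ) ^ (2 * finrank ℝ U) := by fun_prop
      have h2 : Tendsto (fun δ : NNReal => (1 + δ) ^ (2 * finrank ℝ U)) (𝓝[>] 0) (𝓝 1) := by
        simpa using (hc.tendsto 0).mono_left nhdsWithin_le_nhds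
      have := ENNReal.tendsto_coe.2 h2
      simpa using this
    simpa using ENNReal.Tendsto.mul_const h1 (Or.inl one_ne_zero)
  ext s hs
  have hD1 : ν₁ (s ∩ D) = ν₂ (s ∩ D) := by
    have hk := key (s ∩ D) (hs.inter hDm) inter_subset_right
    refine le_antisymm (ge_of_tendsto (hlim _) ?_) (ge_of_tendsto (hlim _) ?_)
    · filter_upwards [self_mem_nhdsWithin] with δ hδ using (hk δ hδ).1
    · filter_upwards [self_mem_nhdsWithin] with δ hδ using (hk δ hδ).2
  have hsplit : ∀ ν : Measure U, ν Dᶜ = 0 → ν s = ν (s ∩ D) := fun ν hν =>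
    (measure_inter_conull hν).symm
  rw [hsplit ν₁ hν₁0, hsplit ν₂ hν₂0, hD1]

/-- Change of variables in surface integrals. -/
theorem map_withDensity_normDet_eq_restrict {f : U → V} {K : NNReal}
    (hK : LipschitzWith K f) (hf : ∀ x y, ‖x - y‖ ≤ ‖f x - f y‖) :
    (volume.withDensity fun x => ENNReal.ofReal (fderiv ℝ f x).toLinearMap.normDet).map f =
      (μHE[finrank ℝ U] : Measure V).restrict (range f) := by
  rw [← comap_euclideanHausdorffMeasure_eq_withDensity hK hf,
    (measurableEmbedding_of_expanding hK hf).map_comap]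

end Area

/-! ### Graph coordinates -/

section Chart

/-- The Euclidean plane. -/
abbrev E2 : Type := EuclideanSpace ℝ (Fin 2)

/-- Cartesian coordinates split into a horizontal and a vertical part. -/
noncomputable def splitVertical : (E2 × ℝ) ≃L[ℝ] E3 :=
  LinearEquiv.toContinuousLinearEquiv
    { toFun := fun p => !₂[p.1 0, p.1 1, p.2]
      invFun := fun y => (!₂[y 0, y 1], y 2)
      map_add' := fun p q => by ext i; fin_cases i <;> simp
      map_smul' := fun c p => by ext i; fin_cases i <;> simp
      left_inv := fun p => by
        refine Prod.ext ?_ rfl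
        ext i; fin_cases i <;> simp
      right_inv := fun y => by ext i; fin_cases i <;> simp }

theorem splitVertical_apply (p : E2 × ℝ) : splitVertical p = !₂[p.1 0, p.1 1, p.2] := rfl

theorem norm_sq_splitVertical (p : E2 × ℝ) : ‖splitVertical p‖ ^ 2 = ‖p.1‖ ^ 2 + p.2 ^ 2 := by
  rw [splitVertical_apply, EuclideanSpace.norm_sq_eq, EuclideanSpace.norm_sq_eq, Fin.sum_univ_three,
    Fin.sum_univ_two]
  simp

theorem inner_splitVertical (p q : E2 × ℝ) :
    inner ℝ (splitVertical p) (splitVertical q) = inner ℝ p.1 q.1 + p.2 * q.2 := by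
  simp only [splitVertical_apply, PiLp.inner_apply, Fin.sum_univ_three, Fin.sum_univ_two]
  simp [mul_comm]

theorem measurePreserving_splitVertical : MeasurePreserving splitVertical := by
  have h1 : MeasurePreserving (fun p : E2 × ℝ => (p.2, (WithLp.ofLp p.1 : Fin 2 → ℝ)))
      volume volume :=
    (Measure.measurePreserving_swap (μ := (volume : Measure (Fin 2 → ℝ)))
      (ν := (volume : Measure ℝ))).comp
      ((PiLp.volume_preserving_ofLp (Fin 2)).prod (MeasurePreserving.id volume))
  have h2 := (volume_preserving_piFinSuccAbove (fun _ : Fin 3 => ℝ) 2).symm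
  have h3 := (PiLp.volume_preserving_toLp (Fin 3)).comp (h2.comp h1)
  convert! h3 using 1
  ext p i
  fin_cases i <;> rfl

variable (Φ : E3 ≃ₗᵢ[ℝ] E3) {g : E2 → ℝ}

/-- The coordinates `(x, s)` in which `s` is the height above the graph of `g`. -/
noncomputable def graphChart (hg : Continuous g) : (E2 × ℝ) ≃ₜ E3 where
  toFun p := Φ.symm (splitVertical (p.1, g p.1 + p.2))
  invFun y := ((splitVertical.symm (Φ y)).1,
    (splitVertical.symm (Φ y)).2 - g (splitVertical.symm (Φ y)).1)
  left_inv p := by simp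
  right_inv y := by simp
  continuous_toFun := by fun_prop
  continuous_invFun := by fun_prop

theorem graphChart_apply (hg : Continuous g) (p : E2 × ℝ) :
    graphChart Φ hg p = Φ.symm (splitVertical (p.1, g p.1 + p.2)) := rfl

theorem graphChart_symm_apply (hg : Continuous g) (y : E3) :
    (graphChart Φ hg).symm y = ((splitVertical.symm (Φ y)).1,
    (splitVertical.symm (Φ y)).2 - g (splitVertical.symm (Φ y)).1) := rfl

/-- The chart is a rigid motion after a shear that translates each vertical line, so Fubini suffices
and `g` need not be differentiable. -/
theorem measurePreserving_graphChart (hg : Continuous g) :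
    MeasurePreserving (graphChart Φ hg) := by
  have h1 : MeasurePreserving (fun p : E2 × ℝ => (p.1, g p.1 + p.2)) volume volume := by
    refine (MeasurePreserving.id volume).skew_product (g := fun x s => g x + s) ?_ ?_
    · exact ((hg.comp continuous_fst).add continuous_snd).measurable
    · exact Eventually.of_forall fun x => (measurePreserving_add_left volume (g x)).map_eq
  exact Φ.symm.measurePreserving.comp (measurePreserving_splitVertical.comp h1)

theorem measurableEmbedding_graphChart (hg : Continuous g) :
    MeasurableEmbedding (graphChart Φ hg) := (graphChart Φ hg).measurableEmbedding

/-- The derivative of the height above the graph in direction `v`. -/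
noncomputable def heightDeriv (g : E2 → ℝ) (x : E2) (v : E3) : ℝ :=
  (splitVertical.symm (Φ v)).2 - fderiv ℝ g x (splitVertical.symm (Φ v)).1

/-- The downward normal vector to the graph, of length the area density. -/
noncomputable def graphNormal (g : E2 → ℝ) (x : E2) : E3 :=
  Φ.symm (splitVertical (gradient g x, -1))

/-- Hence the normal is minus the gradient of the height function, the form in which it enters the
flux. -/
theorem inner_graphNormal (x : E2) (v : E3) :
    inner ℝ v (graphNormal Φ g x) = - heightDeriv Φ g x v := by
  rw [graphNormal, ← Φ.inner_map_map, Φ.apply_symm_apply]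
  conv_lhs => rw [← splitVertical.apply_symm_apply (Φ v), inner_splitVertical]
  rw [heightDeriv, real_inner_comm, inner_gradient_left]
  ring

theorem norm_sq_graphNormal (x : E2) :
    ‖graphNormal Φ g x‖ ^ 2 = ‖fderiv ℝ g x‖ ^ 2 + 1 := by
  rw [graphNormal, LinearIsometryEquiv.norm_map, norm_sq_splitVertical, gradient,
    LinearIsometryEquiv.norm_map]
  norm_num

theorem norm_graphNormal_pos (x : E2) : 0 < ‖graphNormal Φ g x‖ := by
  have := norm_sq_graphNormal Φ (g := g) x
  by_contra h
  have h0 : ‖graphNormal Φ g x‖ = 0 := le_antisymm (not_lt.1 h) (norm_nonneg _)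
  rw [h0] at this
  nlinarith [sq_nonneg ‖fderiv ℝ g x‖]

theorem measurable_graphNormal : Measurable (graphNormal Φ g) := by
  have h : Measurable (gradient g) :=
    (InnerProductSpace.toDual ℝ E2).symm.continuous.measurable.comp (measurable_fderiv ℝ g)
  exact Φ.symm.continuous.measurable.comp
    (splitVertical.continuous.measurable.comp (h.prodMk measurable_const))

theorem norm_graphNormal_le {K : NNReal} (hg : LipschitzWith K g) (x : E2) :
    ‖graphNormal Φ g x‖ ≤ K + 1 := by
  have h := norm_sq_graphNormal Φ (g := g) x
  have h1 : ‖fderiv ℝ g x‖ ≤ K := norm_fderiv_le_of_lipschitz ℝ hg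
  have h2 : (0 : ℝ) ≤ K := K.2
  refine abs_le_of_sq_le_sq' ?_ (by positivity) |>.2
  nlinarith [norm_nonneg (fderiv ℝ g x)]

/-- The parametrisation of the graph. -/
noncomputable def graphMap (g : E2 → ℝ) (x : E2) : E3 := Φ.symm (splitVertical (x, g x))

theorem graphChart_zero (hg : Continuous g) (x : E2) : graphChart Φ hg (x, 0) = graphMap Φ g x := by
  simp [graphChart_apply, graphMap]

theorem norm_sq_graphMap_sub (x y : E2) :
    ‖graphMap Φ g x - graphMap Φ g y‖ ^ 2 = ‖x - y‖ ^ 2 + (g x - g y) ^ 2 := by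
  rw [graphMap, graphMap, ← map_sub, LinearIsometryEquiv.norm_map, ← map_sub, norm_sq_splitVertical]
  rfl

theorem norm_sub_le_norm_graphMap_sub (x y : E2) :
    ‖x - y‖ ≤ ‖graphMap Φ g x - graphMap Φ g y‖ := by
  have := norm_sq_graphMap_sub Φ (g := g) x y
  refine abs_le_of_sq_le_sq' ?_ (by positivity) |>.2
  nlinarith [sq_nonneg (g x - g y)]

theorem lipschitzWith_graphMap {K : NNReal} (hg : LipschitzWith K g) :
    LipschitzWith (K + 1) (graphMap Φ g) := by
  refine LipschitzWith.of_dist_le_mul fun x y => ?_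
  rw [dist_eq_norm, dist_eq_norm]
  have h1 := norm_sq_graphMap_sub Φ (g := g) x y
  have h2 := hg.dist_le_mul x y
  rw [Real.dist_eq, dist_eq_norm] at h2
  have h3 : (g x - g y) ^ 2 ≤ (K * ‖x - y‖) ^ 2 := sq_le_sq' (by linarith [neg_abs_le (g x - g y)])
    (by linarith [le_abs_self (g x - g y)])
  refine abs_le_of_sq_le_sq' ?_ (by positivity) |>.2
  push_cast
  have h4 : (0 : ℝ) ≤ K * ‖x - y‖ * ‖x - y‖ := by positivity
  nlinarith

theorem hasFDerivAt_graphMap {x : E2} (hg : DifferentiableAt ℝ g x) :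
    HasFDerivAt (graphMap Φ g) (Φ.symm.toContinuousLinearEquiv.toContinuousLinearMap ∘L
      (splitVertical.toContinuousLinearMap ∘L
        ((ContinuousLinearMap.id ℝ E2).prod (fderiv ℝ g x)))) x := by
  have h1 : HasFDerivAt (fun x => (x, g x)) ((ContinuousLinearMap.id ℝ E2).prod (fderiv ℝ g x)) x :=
    (hasFDerivAt_id x).prodMk hg.hasFDerivAt
  exact Φ.symm.toContinuousLinearEquiv.toContinuousLinearMap.hasFDerivAt.comp x
    (splitVertical.toContinuousLinearMap.hasFDerivAt.comp x h1)

/-- With tangent vectors `(eᵢ, ∂ᵢg)`, the Gram determinant `(1 + g₀²)(1 + g₁²) - (g₀ g₁)²` collapses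
to `1 + |∇g|²`, where `gᵢ = ∂ᵢg`. -/
theorem normDet_fderiv_graphMap {x : E2} (hg : DifferentiableAt ℝ g x) :
    (fderiv ℝ (graphMap Φ g) x).toLinearMap.normDet = ‖graphNormal Φ g x‖ := by
  have hb := LinearMap.normDet_sq_eq_det_gram (fderiv ℝ (graphMap Φ g) x).toLinearMap
    (EuclideanSpace.basisFun (Fin 2) ℝ)
  have hn : ‖fderiv ℝ g x‖ ^ 2 = (fderiv ℝ g x (EuclideanSpace.single 0 1)) ^ 2 +
      (fderiv ℝ g x (EuclideanSpace.single 1 1)) ^ 2 := by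
    have h1 : ‖fderiv ℝ g x‖ = ‖gradient g x‖ := by
      rw [gradient, LinearIsometryEquiv.norm_map]
    have h2 : ∀ i, gradient g x i = fderiv ℝ g x (EuclideanSpace.single i 1) := fun i => by
      rw [← inner_gradient_left, EuclideanSpace.inner_single_right]
      simp
    rw [h1, EuclideanSpace.norm_sq_eq, Fin.sum_univ_two, ← h2, ← h2]
    simp
  rw [← sq_eq_sq₀ (LinearMap.normDet_nonneg _) (norm_nonneg _), norm_sq_graphNormal, hn]
  rw [(hasFDerivAt_graphMap Φ hg).fderiv] at hb ⊢
  refine Eq.trans hb ?_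
  rw [Matrix.det_fin_two]
  simp only [Matrix.gram_apply, ContinuousLinearMap.coe_coe, ContinuousLinearMap.comp_apply,
    ContinuousLinearEquiv.coe_coe, LinearIsometryEquiv.coe_toContinuousLinearEquiv,
    LinearIsometryEquiv.inner_map_map, inner_splitVertical, ContinuousLinearMap.prod_apply,
    ContinuousLinearMap.id_apply, EuclideanSpace.basisFun_apply]
  simp [EuclideanSpace.inner_single_right]
  ring

theorem restrict_range_graphMap {K : NNReal} (hg : LipschitzWith K g) :
    (Measure.euclideanHausdorffMeasure 2).restrict (range (graphMap Φ g)) =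
      (volume.withDensity fun x => (‖graphNormal Φ g x‖₊ : ENNReal)).map (graphMap Φ g) := by
  have h := map_withDensity_normDet_eq_restrict (lipschitzWith_graphMap Φ hg)
    (norm_sub_le_norm_graphMap_sub Φ)
  rw [finrank_euclideanSpace_fin] at h
  rw [← h]
  congr 1
  refine withDensity_congr_ae ?_
  filter_upwards [hg.ae_differentiableAt] with x hx
  rw [normDet_fderiv_graphMap Φ hx, ofReal_norm, enorm_eq_nnnorm]

theorem measurableEmbedding_graphMap {K : NNReal} (hg : LipschitzWith K g) :
    MeasurableEmbedding (graphMap Φ g) :=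
  measurableEmbedding_of_expanding (lipschitzWith_graphMap Φ hg) (norm_sub_le_norm_graphMap_sub Φ)

theorem integrable_restrict_range_graphMap_iff {K : NNReal} (hg : LipschitzWith K g)
    {F : Type*} [NormedAddCommGroup F] [NormedSpace ℝ F] (f : E3 → F) :
    Integrable f ((Measure.euclideanHausdorffMeasure 2).restrict (range (graphMap Φ g))) ↔
      Integrable (fun x => ‖graphNormal Φ g x‖ • f (graphMap Φ g x)) := by
  rw [restrict_range_graphMap Φ hg, (measurableEmbedding_graphMap Φ hg).integrable_map_iff,
    integrable_withDensity_iff_integrable_coe_smul (measurable_graphNormal Φ).nnnorm]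
  rfl

/-- Surface integrals over a Lipschitz graph. -/
theorem integral_restrict_range_graphMap {K : NNReal} (hg : LipschitzWith K g)
    {F : Type*} [NormedAddCommGroup F] [NormedSpace ℝ F] (f : E3 → F) :
    ∫ y, f y ∂((Measure.euclideanHausdorffMeasure 2).restrict (range (graphMap Φ g))) =
      ∫ x, ‖graphNormal Φ g x‖ • f (graphMap Φ g x) := by
  rw [restrict_range_graphMap Φ hg, (measurableEmbedding_graphMap Φ hg).integral_map,
    integral_withDensity_eq_integral_smul (measurable_graphNormal Φ).nnnorm]
  rfl

/-- The part of `Ω` in `U` is the part of `U` above the graph of `g`. -/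
def IsGraphDomainOn (hg : Continuous g) (Ω U : Set E3) : Prop :=
  ∀ y ∈ U, y ∈ Ω ↔ 0 < ((graphChart Φ hg).symm y).2

/-- To first order the height of `y` above the graph is `-⟨y - x, N⟩`, and the sign of the height
decides membership in `Ω`. The error comes only from linearising `g`, and horizontal projection does
not increase distances. -/
theorem isOuterUnitNormal_graphNormal {Ω U : Set E3} (hg : Continuous g) (hU : IsOpen U)
    (h : IsGraphDomainOn Φ hg Ω U) {x : E2} (hx : graphMap Φ g x ∈ U)
    (hgx : DifferentiableAt ℝ g x) :
    IsOuterUnitNormal Ω (graphMap Φ g x) (‖graphNormal Φ g x‖⁻¹ • graphNormal Φ g x) := by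
  have hN := norm_graphNormal_pos Φ (g := g) x
  refine ⟨by rw [norm_smul, norm_inv, norm_norm, inv_mul_cancel₀ hN.ne'], fun δ hδ => ?_⟩
  let q : E3 → E2 := fun y => (splitVertical.symm (Φ y)).1
  have hq : Continuous q := by fun_prop
  have hqx : q (graphMap Φ g x) = x := by simp [q, graphMap]
  -- The tolerance carries a factor `‖N‖` because normalising `N` later divides by it.
  have h1 : ∀ᶠ z in 𝓝 x, ‖g z - g x - fderiv ℝ g x (z - x)‖ ≤
      (δ * ‖graphNormal Φ g x‖) * ‖z - x‖ := hgx.hasFDerivAt.isLittleO.def (by positivity)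
  have h2 : ∀ᶠ y in 𝓝 (graphMap Φ g x), ‖g (q y) - g x - fderiv ℝ g x (q y - x)‖ ≤
      (δ * ‖graphNormal Φ g x‖) * ‖q y - x‖ := by
    refine hq.continuousAt.eventually (p := fun z => ‖g z - g x - fderiv ℝ g x (z - x)‖ ≤
      (δ * ‖graphNormal Φ g x‖) * ‖z - x‖) ?_
    rwa [hqx]
  filter_upwards [h2, hU.mem_nhds hx] with y hy hyU
  have hle : ‖q y - x‖ ≤ ‖y - graphMap Φ g x‖ := by
    rw [← Φ.norm_map, ← splitVertical.apply_symm_apply (Φ (y - graphMap Φ g x))]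
    refine abs_le_of_sq_le_sq' ?_ (norm_nonneg _) |>.2
    rw [norm_sq_splitVertical, map_sub, map_sub, Prod.fst_sub]
    change ‖q y - x‖ ^ 2 ≤ ‖q y - q (graphMap Φ g x)‖ ^ 2 + _
    rw [hqx]
    nlinarith [sq_nonneg (splitVertical.symm (Φ y) - splitVertical.symm (Φ (graphMap Φ g x))).2]
  have hin : inner ℝ (y - graphMap Φ g x) (‖graphNormal Φ g x‖⁻¹ • graphNormal Φ g x) =
      ‖graphNormal Φ g x‖⁻¹ * (fderiv ℝ g x (q y - x) + g x - (splitVertical.symm (Φ y)).2) := by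
    rw [real_inner_smul_right, inner_graphNormal, heightDeriv]
    congr 1
    have : (splitVertical.symm (Φ (y - graphMap Φ g x))) =
        (q y - x, (splitVertical.symm (Φ y)).2 - g x) := by
      rw [map_sub, map_sub]
      simp [graphMap, q]
      rfl
    rw [this]
    ring
  rw [hin]
  have hbd : (δ * ‖graphNormal Φ g x‖) * ‖q y - x‖ ≤
      ‖graphNormal Φ g x‖ * (δ * ‖y - graphMap Φ g x‖) := by
    rw [mul_comm δ, mul_assoc]
    gcongr
  have hy' := abs_le.1 (Real.norm_eq_abs _ ▸ hy)
  have hiff := h y hyU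
  rw [graphChart_symm_apply] at hiff
  change y ∈ Ω ↔ 0 < (splitVertical.symm (Φ y)).2 - g (q y) at hiff
  constructor
  · intro hyΩ
    rw [inv_mul_le_iff₀ hN]
    linarith [hiff.1 hyΩ]
  · intro hyΩ
    rw [le_inv_mul_iff₀ hN]
    have := not_lt.1 (fun hc => hyΩ (hiff.2 hc))
    linarith

theorem outerNormal_eq {Ω : Set E3} {x ν : E3} (h : IsOuterUnitNormal Ω x ν) :
    outerNormal Ω x = ν := by
  have hex : ∃ ν, IsOuterUnitNormal Ω x ν := ⟨ν, h⟩
  rw [outerNormal, dif_pos hex]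
  exact hex.choose_spec.unique h

/-- Points of negative height have a neighbourhood missing `Ω`; points of height zero are limits of
points of `Ω` vertically above them. -/
theorem frontier_inter_eq_of_isGraphDomainOn {Ω U : Set E3} (hg : Continuous g) (hΩ : IsOpen Ω)
    (hU : IsOpen U) (h : IsGraphDomainOn Φ hg Ω U) :
    frontier Ω ∩ U = range (graphMap Φ g) ∩ U := by
  ext y
  refine and_congr_left fun hyU => ?_
  have hrange : y ∈ range (graphMap Φ g) ↔ ((graphChart Φ hg).symm y).2 = 0 := by
    constructor
    · rintro ⟨x, rfl⟩
      rw [← graphChart_zero Φ hg, Homeomorph.symm_apply_apply]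
    · intro hy
      refine ⟨((graphChart Φ hg).symm y).1, ?_⟩
      rw [← graphChart_zero Φ hg, ← hy, Prod.mk.eta, Homeomorph.apply_symm_apply]
  rw [hrange, hΩ.frontier_eq, Set.mem_sdiff, h y hyU, not_lt]
  constructor
  · rintro ⟨hcl, hle⟩
    refine le_antisymm hle (not_lt.1 fun hlt => ?_)
    have hop : IsOpen (U ∩ {z | ((graphChart Φ hg).symm z).2 < 0}) :=
      hU.inter (isOpen_lt (continuous_snd.comp (graphChart Φ hg).symm.continuous) continuous_const)
    obtain ⟨z, hz, hzΩ⟩ := mem_closure_iff.1 hcl _ hop ⟨hyU, hlt⟩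
    exact absurd ((h z hz.1).1 hzΩ) (not_lt.2 (le_of_lt hz.2))
  · intro hy
    refine ⟨?_, hy.le⟩
    set x := ((graphChart Φ hg).symm y).1
    have hyx : graphChart Φ hg (x, 0) = y := by
      rw [← hy, Prod.mk.eta, Homeomorph.apply_symm_apply]
    have hc : Tendsto (fun s : ℝ => graphChart Φ hg (x, s)) (𝓝[>] 0) (𝓝 y) := by
      have : Continuous fun s : ℝ => graphChart Φ hg (x, s) := by fun_prop
      rw [← hyx]
      exact (this.tendsto 0).mono_left nhdsWithin_le_nhds
    refine mem_closure_of_tendsto hc ?_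
    filter_upwards [hc.eventually (hU.mem_nhds hyU), self_mem_nhdsWithin] with s hs hs0
    rw [h _ hs, Homeomorph.symm_apply_apply]
    exact hs0

end Chart

/-! ### The divergence theorem above a Lipschitz graph -/

section Divergence

/-- The divergence of a vector field. -/
noncomputable def divergence (F : E3 → E3) (x : E3) : ℝ :=
  ∑ i, fderiv ℝ F x (EuclideanSpace.single i 1) i

theorem divergence_congr {F G : E3 → E3} {x : E3} (h : F =ᶠ[𝓝 x] G) :
    divergence F x = divergence G x := by
  simp only [divergence, h.fderiv_eq]

theorem hasCompactSupport_coord {w : E3 → E3} (hc : HasCompactSupport w) (i : Fin 3) :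
    HasCompactSupport fun y => w y i :=
  hc.comp_left (g := fun v : E3 => v i) rfl

theorem contDiff_coord {w : E3 → E3} {n : WithTop ℕ∞} (hw : ContDiff ℝ n w) (i : Fin 3) :
    ContDiff ℝ n fun y => w y i :=
  (EuclideanSpace.proj (𝕜 := ℝ) i).contDiff.comp hw

theorem fderiv_coord {w : E3 → E3} {y : E3} (hw : DifferentiableAt ℝ w y) (i : Fin 3) (v : E3) :
    fderiv ℝ (fun y => w y i) y v = fderiv ℝ w y v i := by
  have := ((EuclideanSpace.proj (𝕜 := ℝ) i : E3 →L[ℝ] ℝ).hasFDerivAt.comp y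
    hw.hasFDerivAt).fderiv
  change fderiv ℝ (fun y => w y i) y = _ at this
  rw [this]
  rfl

theorem sum_coord_smul_single (v : E3) : ∑ i, v i • EuclideanSpace.single i (1 : ℝ) = v := by
  ext j
  fin_cases j <;> simp [Fin.sum_univ_three]

/-- Integration by parts of a Lipschitz function against a divergence. -/
theorem integral_mul_divergence {φ : E3 → ℝ} {C : NNReal} (hφ : LipschitzWith C φ) {w : E3 → E3}
    (hw : ContDiff ℝ 1 w) (hc : HasCompactSupport w) :
    ∫ y, φ y * divergence w y = - ∫ y, fderiv ℝ φ y (w y) := by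
  have hd : Differentiable ℝ w := hw.differentiable one_ne_zero
  have hparts : ∀ i : Fin 3,
      ∫ y, lineDeriv ℝ φ y (EuclideanSpace.single i 1) * w y i =
        - ∫ y, fderiv ℝ w y (EuclideanSpace.single i 1) i * φ y := by
    intro i
    obtain ⟨D, hD⟩ := (contDiff_coord hw i).lipschitzWith_of_hasCompactSupport
      (hasCompactSupport_coord hc i) one_ne_zero
    rw [hφ.integral_lineDeriv_mul_eq hD (hasCompactSupport_coord hc i), ← integral_neg]
    congr 1
    ext y
    rw [((contDiff_coord hw i).differentiable one_ne_zero y).lineDeriv_eq_fderiv,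
      fderiv_coord (hd y), map_neg]
    simp
  have hint1 : ∀ i : Fin 3,
      Integrable fun y => lineDeriv ℝ φ y (EuclideanSpace.single i 1) * w y i := by
    intro i
    have h1 : Integrable fun y => w y i :=
      (contDiff_coord hw i).continuous.integrable_of_hasCompactSupport (hasCompactSupport_coord hc i)
    exact h1.bdd_mul (c := C * ‖(EuclideanSpace.single i (1 : ℝ) : E3)‖)
      (aestronglyMeasurable_lineDeriv hφ.continuous _)
      (.of_forall fun y => norm_lineDeriv_le_of_lipschitz ℝ hφ)
  have hint2 : ∀ i : Fin 3,
      Integrable fun y => fderiv ℝ w y (EuclideanSpace.single i 1) i * φ y := by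
    intro i
    have hcont : Continuous fun y => fderiv ℝ w y (EuclideanSpace.single i 1) i * φ y := by
      have h := hw.continuous_fderiv one_ne_zero
      have h2 := hφ.continuous
      fun_prop
    refine hcont.integrable_of_hasCompactSupport ?_
    exact HasCompactSupport.mul_right ((hc.fderiv ℝ).comp_left
      (g := fun L : E3 →L[ℝ] E3 => L (EuclideanSpace.single i 1) i) (by simp))
  have h1 : ∫ y, fderiv ℝ φ y (w y) =
      ∑ i, ∫ y, lineDeriv ℝ φ y (EuclideanSpace.single i 1) * w y i := by
    rw [← integral_finsetSum _ fun i _ => hint1 i]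
    refine integral_congr_ae ?_
    -- The integration by parts was done with line derivatives; by Rademacher they are values of the
    -- differential almost everywhere.
    filter_upwards [hφ.ae_differentiableAt] with y hy
    conv_lhs => rw [← sum_coord_smul_single (w y)]
    simp only [map_sum, map_smul, hy.lineDeriv_eq_fderiv, smul_eq_mul, mul_comm]
  rw [h1, ← Finset.sum_neg_distrib]
  simp only [hparts, neg_neg]
  rw [← integral_finsetSum _ fun i _ => hint2 i]
  congr 1
  ext y
  rw [divergence, Finset.mul_sum]
  exact Finset.sum_congr rfl fun i _ => mul_comm _ _

theorem integral_divergence_eq_zero {w : E3 → E3} (hw : ContDiff ℝ 1 w)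
    (hc : HasCompactSupport w) : ∫ y, divergence w y = 0 := by
  have := integral_mul_divergence (LipschitzWith.const (1 : ℝ)) hw hc
  simpa using this

end Divergence

/-! ### A piecewise linear cutoff -/

section Cutoff

/-- The piecewise linear function which is `0` below `ε` and `1` above `2 * ε`. -/
noncomputable def ramp (ε r : ℝ) : ℝ := max 0 (min 1 (ε⁻¹ * r - 1))

variable {ε : ℝ}

theorem ramp_nonneg (ε r : ℝ) : 0 ≤ ramp ε r := le_max_left _ _

theorem ramp_le_one (ε r : ℝ) : ramp ε r ≤ 1 := max_le zero_le_one (min_le_left _ _)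

theorem ramp_of_le (hε : 0 < ε) {r : ℝ} (hr : r ≤ ε) : ramp ε r = 0 := by
  have : ε⁻¹ * r ≤ 1 := by rw [inv_mul_le_iff₀ hε]; linarith
  exact max_eq_left ((min_le_right _ _).trans (by linarith))

theorem ramp_of_ge (hε : 0 < ε) {r : ℝ} (hr : 2 * ε ≤ r) : ramp ε r = 1 := by
  have : 2 ≤ ε⁻¹ * r := by rw [le_inv_mul_iff₀ hε]; linarith
  rw [ramp, min_eq_left (by linarith), max_eq_right zero_le_one]

theorem ramp_of_mem (hε : 0 < ε) {r : ℝ} (hr : r ∈ Icc ε (2 * ε)) : ramp ε r = ε⁻¹ * r - 1 := by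
  have h1 : ε⁻¹ * r ≤ 2 := by rw [inv_mul_le_iff₀ hε]; linarith [hr.2]
  have h2 : 1 ≤ ε⁻¹ * r := by rw [le_inv_mul_iff₀ hε]; linarith [hr.1]
  rw [ramp, min_eq_right (by linarith), max_eq_right (by linarith)]

theorem hasDerivAt_ramp (hε : 0 < ε) {r : ℝ} (h1 : r ≠ ε) (h2 : r ≠ 2 * ε) :
    HasDerivAt (ramp ε) ((Ioo ε (2 * ε)).indicator (fun _ => ε⁻¹) r) r := by
  rcases lt_or_gt_of_ne h1 with h1 | h1
  · rw [indicator_of_notMem (fun h => absurd h.1 (not_lt.2 h1.le))]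
    refine (hasDerivAt_const r (0 : ℝ)).congr_of_eventuallyEq ?_
    filter_upwards [Iio_mem_nhds h1] with z hz using ramp_of_le hε (le_of_lt hz)
  rcases lt_or_gt_of_ne h2 with h2 | h2
  · rw [indicator_of_mem (show r ∈ Ioo ε (2 * ε) from ⟨h1, h2⟩)]
    have : HasDerivAt (fun r => ε⁻¹ * r - 1) ε⁻¹ r := by
      simpa using ((hasDerivAt_id r).const_mul ε⁻¹).sub_const 1
    refine this.congr_of_eventuallyEq ?_
    filter_upwards [Ioo_mem_nhds h1 h2] with z hz using ramp_of_mem hε ⟨hz.1.le, hz.2.le⟩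
  · rw [indicator_of_notMem (fun h => absurd h.2 (not_lt.2 h2.le))]
    refine (hasDerivAt_const r (1 : ℝ)).congr_of_eventuallyEq ?_
    filter_upwards [Ioi_mem_nhds h2] with z hz using ramp_of_ge hε (le_of_lt hz)

theorem exists_lipschitzWith_ramp (ε : ℝ) : ∃ C, LipschitzWith C (ramp ε) :=
  ⟨_, (((lipschitzWith_smul (β := ℝ) ε⁻¹).sub (LipschitzWith.const 1)).const_min 1).const_max 0⟩

end Cutoff

/-! ### Flux through a thin layer above the graph -/

section GraphDivergence

variable (Φ : E3 ≃ₗᵢ[ℝ] E3) {g : E2 → ℝ} {K : NNReal}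

theorem exists_lipschitzWith_height (hg : LipschitzWith K g) :
    ∃ C, LipschitzWith C fun y => ((graphChart Φ hg.continuous).symm y).2 := by
  have h1 : ∃ C, LipschitzWith C fun y : E3 => splitVertical.symm (Φ y) :=
    ⟨_, splitVertical.symm.lipschitz.comp Φ.lipschitz⟩
  obtain ⟨C, hC⟩ := h1
  exact ⟨_, (LipschitzWith.prod_snd.comp hC).sub (hg.comp (LipschitzWith.prod_fst.comp hC))⟩

theorem hasFDerivAt_height (hg : LipschitzWith K g) {p : E2 × ℝ} (hp : DifferentiableAt ℝ g p.1) :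
    ∃ L : E3 →L[ℝ] ℝ, (∀ v, L v = heightDeriv Φ g p.1 v) ∧
      HasFDerivAt (fun y => ((graphChart Φ hg.continuous).symm y).2) L
        (graphChart Φ hg.continuous p) := by
  let S : E3 →L[ℝ] E2 × ℝ := splitVertical.symm.toContinuousLinearMap ∘L
    Φ.toContinuousLinearEquiv.toContinuousLinearMap
  have hS : ∀ y, S y = splitVertical.symm (Φ y) := fun _ => rfl
  have hp1 : (S (graphChart Φ hg.continuous p)).1 = p.1 := by
    rw [hS, graphChart_apply]; simp
  have h1 : HasFDerivAt (fun y => (S y).2) (ContinuousLinearMap.snd ℝ E2 ℝ ∘L S)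
      (graphChart Φ hg.continuous p) := (ContinuousLinearMap.snd ℝ E2 ℝ ∘L S).hasFDerivAt
  have h2 : HasFDerivAt (fun y => (S y).1) (ContinuousLinearMap.fst ℝ E2 ℝ ∘L S)
      (graphChart Φ hg.continuous p) := (ContinuousLinearMap.fst ℝ E2 ℝ ∘L S).hasFDerivAt
  have h3 : HasFDerivAt g (fderiv ℝ g p.1) (S (graphChart Φ hg.continuous p)).1 := by
    rw [hp1]; exact hp.hasFDerivAt
  have h4 := HasFDerivAt.comp (g := g) (f := fun y => (S y).1) _ h3 h2
  exact ⟨_, fun v => rfl, h1.sub h4⟩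

theorem fderiv_ramp_height (hg : LipschitzWith K g) {ε : ℝ} (hε : 0 < ε) {p : E2 × ℝ}
    (hp : DifferentiableAt ℝ g p.1) (h1 : p.2 ≠ ε) (h2 : p.2 ≠ 2 * ε) (v : E3) :
    fderiv ℝ (fun y => ramp ε ((graphChart Φ hg.continuous).symm y).2)
      (graphChart Φ hg.continuous p) v =
      - ((Ioo ε (2 * ε)).indicator (fun _ => ε⁻¹) p.2 * inner ℝ v (graphNormal Φ g p.1)) := by
  obtain ⟨L, hL, hd⟩ := hasFDerivAt_height Φ hg hp
  have hr : HasDerivAt (ramp ε) ((Ioo ε (2 * ε)).indicator (fun _ => ε⁻¹) p.2)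
      ((graphChart Φ hg.continuous).symm (graphChart Φ hg.continuous p)).2 := by
    rw [Homeomorph.symm_apply_apply]; exact hasDerivAt_ramp hε h1 h2
  have := (HasDerivAt.comp_hasFDerivAt (h₂ := ramp ε)
    (f := fun y => ((graphChart Φ hg.continuous).symm y).2) _ hr hd).fderiv
  change fderiv ℝ (fun y => ramp ε ((graphChart Φ hg.continuous).symm y).2) _ = _ at this
  rw [this, inner_graphNormal]
  simp [hL]

theorem norm_fst_le_norm_graphChart (hg : Continuous g) (p : E2 × ℝ) :
    ‖p.1‖ ≤ ‖graphChart Φ hg p‖ := by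
  refine abs_le_of_sq_le_sq' ?_ (norm_nonneg _) |>.2
  rw [graphChart_apply, LinearIsometryEquiv.norm_map, norm_sq_splitVertical]
  nlinarith [sq_nonneg (g p.1 + p.2)]

theorem exists_contDiff_zero_one_nhds {s t : Set E3} (hs : IsClosed s) (ht : IsClosed t)
    (hd : Disjoint s t) : ∃ κ : E3 → ℝ, ContDiff ℝ 1 κ ∧ (∀ x ∈ s, ∀ᶠ y in 𝓝 x, κ y = 0) ∧
      ∀ x ∈ t, ∀ᶠ y in 𝓝 x, κ y = 1 := by
  obtain ⟨κ, h0, h1, -⟩ := exists_contMDiffMap_zero_one_nhds_of_isClosed (n := 1)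
    (modelWithCornersSelf ℝ E3) hs ht hd
  exact ⟨κ, contMDiff_iff_contDiff.1 κ.contMDiff, eventually_nhdsSet_iff_forall.1 h0,
    eventually_nhdsSet_iff_forall.1 h1⟩

theorem contDiff_smul_of_eventually_zero {κ : E3 → ℝ} {W : E3 → E3} {V : Set E3} (hV : IsOpen V)
    (hκ : ContDiff ℝ 1 κ) (hW : ContDiffOn ℝ 1 W V) (h0 : ∀ x ∉ V, ∀ᶠ y in 𝓝 x, κ y = 0) :
    ContDiff ℝ 1 fun y => κ y • W y := by
  rw [contDiff_iff_contDiffAt]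
  intro y
  by_cases hy : y ∈ V
  · exact hκ.contDiffAt.smul (hW.contDiffAt (hV.mem_nhds hy))
  · have h : (fun y => κ y • W y) =ᶠ[𝓝 y] fun _ => (0 : E3) := by
      filter_upwards [h0 y hy] with z hz
      rw [hz, zero_smul]
    exact ContDiffAt.congr_of_eventuallyEq contDiffAt_const h

/-- Flux through the layer of heights between `ε` and `2 * ε`. -/
theorem integral_ramp_mul_divergence (hg : LipschitzWith K g) {W : E3 → E3}
    (hWc : HasCompactSupport W)
    (hW : ContDiffOn ℝ 1 W {y | 0 < ((graphChart Φ hg.continuous).symm y).2}) {ε : ℝ} (hε : 0 < ε) :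
    ∫ y, ramp ε ((graphChart Φ hg.continuous).symm y).2 * divergence W y =
      ∫ p : E2 × ℝ, (Ioo ε (2 * ε)).indicator (fun _ => ε⁻¹) p.2 *
        inner ℝ (W (graphChart Φ hg.continuous p)) (graphNormal Φ g p.1) := by
  set χ := graphChart Φ hg.continuous with hχ
  have hρ : Continuous fun y => (χ.symm y).2 := by fun_prop
  -- `W` may jump across the graph. The factor `κ` vanishes near all points of nonpositive height
  -- and is 1 near heights at least `ε`, where the ramp lives, so `κ W` is globally `C¹` and
  -- replaces `W` unnoticed.
  obtain ⟨κ, hκ, hκ0, hκ1⟩ := exists_contDiff_zero_one_nhds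
    (s := {y | (χ.symm y).2 ≤ 0}) (t := {y | ε ≤ (χ.symm y).2})
    (isClosed_le hρ continuous_const) (isClosed_le continuous_const hρ)
    (disjoint_left.2 fun y h1 h2 => absurd (lt_of_lt_of_le hε h2) (not_lt.2 h1))
  set w : E3 → E3 := fun y => κ y • W y with hw
  have hVo : IsOpen {y | 0 < (χ.symm y).2} := isOpen_lt continuous_const hρ
  have hwd : ContDiff ℝ 1 w := contDiff_smul_of_eventually_zero hVo hκ hW
    fun y hy => hκ0 y (show (χ.symm y).2 ≤ 0 from not_lt.1 hy)
  have hwc : HasCompactSupport w := hWc.mono fun y hy hWy => hy (by simp [hw, hWy])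
  have hwW : ∀ y, ε ≤ (χ.symm y).2 → w =ᶠ[𝓝 y] W := fun y hy => by
    filter_upwards [hκ1 y hy] with z hz
    simp [hw, hz]
  obtain ⟨C₁, hC₁⟩ := exists_lipschitzWith_ramp ε
  obtain ⟨C₂, hC₂⟩ := exists_lipschitzWith_height Φ hg
  have hφ : LipschitzWith (C₁ * C₂) fun y => ramp ε (χ.symm y).2 := hC₁.comp hC₂
  have key := integral_mul_divergence hφ hwd hwc
  have hL : ∀ y, ramp ε (χ.symm y).2 * divergence W y = ramp ε (χ.symm y).2 * divergence w y := by
    intro y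
    rcases le_or_gt ε (χ.symm y).2 with h | h
    · rw [divergence_congr (hwW y h)]
    · rw [ramp_of_le hε h.le, zero_mul, zero_mul]
  simp only [hL]
  rw [key, ← integral_neg, ← (measurePreserving_graphChart Φ hg.continuous).integral_comp
    (measurableEmbedding_graphChart Φ hg.continuous)]
  refine integral_congr_ae ?_
  have hae1 : ∀ᵐ p : E2 × ℝ, DifferentiableAt ℝ g p.1 :=
    Measure.quasiMeasurePreserving_fst.ae hg.ae_differentiableAt
  -- The kinks of the ramp lie on two level sets of the height, which are null.
  have hae2 : ∀ a : ℝ, ∀ᵐ p : E2 × ℝ, p.2 ≠ a := fun a =>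
    Measure.quasiMeasurePreserving_snd.ae (Measure.ae_ne volume a)
  filter_upwards [hae1, hae2 ε, hae2 (2 * ε)] with p hp h1 h2
  rw [fderiv_ramp_height Φ hg hε hp h1 h2, neg_neg]
  by_cases hps : p.2 ∈ Ioo ε (2 * ε)
  · have : ε ≤ (χ.symm (χ p)).2 := by rw [Homeomorph.symm_apply_apply]; exact hps.1.le
    rw [← hχ, (hwW _ this).self_of_nhds]
  · rw [indicator_of_notMem hps, zero_mul, zero_mul]

/-- Rescaling heights by `ε` cancels the density `ε⁻¹` and freezes the layer at `(1, 2)`, ready for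
dominated convergence. The bounds `B` and `R` give integrability for Fubini. -/
theorem integral_layer_eq_scaled {f : E2 × ℝ → ℝ} (hf : Measurable f) {B R ε : ℝ} (hε : 0 < ε)
    (hfB : ∀ p, ‖f p‖ ≤ B) (hfR : ∀ p, R < ‖p.1‖ → f p = 0) :
    ∫ p, (Ioo ε (2 * ε)).indicator (fun _ => ε⁻¹) p.2 * f p =
      ∫ p : E2 × ℝ, (Ioo 1 2).indicator (fun _ => (1 : ℝ)) p.2 * f (p.1, ε * p.2) := by
  have hint : ∀ (a b c : ℝ) (h : E2 × ℝ → ℝ), Measurable h → (∀ p, ‖h p‖ ≤ B) →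
      (∀ p, R < ‖p.1‖ → h p = 0) →
      Integrable fun p : E2 × ℝ => (Ioo a b).indicator (fun _ => c) p.2 * h p := by
    intro a b c h hm hB hR
    have hfin : volume (Metric.closedBall (0 : E2) R ×ˢ Ioo a b) ≠ ⊤ := by
      rw [Measure.volume_eq_prod, Measure.prod_prod]
      exact ENNReal.mul_ne_top measure_closedBall_lt_top.ne (by simp)
    have hme : Measurable fun p : E2 × ℝ => (Ioo a b).indicator (fun _ => c) p.2 * h p :=
      ((measurable_const.indicator measurableSet_Ioo).comp measurable_snd).mul hm
    refine Integrable.mono' ((integrable_indicator_iff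
      (Metric.isClosed_closedBall.measurableSet.prod measurableSet_Ioo)).2
      (integrableOn_const (C := |c| * B) hfin)) hme.aestronglyMeasurable
      (.of_forall fun p => ?_)
    by_cases hp : p ∈ Metric.closedBall (0 : E2) R ×ˢ Ioo a b
    · rw [indicator_of_mem hp, indicator_of_mem hp.2, norm_mul, Real.norm_eq_abs c]
      gcongr
      exact hB p
    · rw [indicator_of_notMem hp]
      by_cases hs : p.2 ∈ Ioo a b
      · have : R < ‖p.1‖ := by
          by_contra hle
          exact hp ⟨by simpa using not_lt.1 hle, hs⟩
        rw [hR p this]; simp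
      · rw [indicator_of_notMem hs]; simp
  rw [Measure.volume_eq_prod, integral_prod _ (hint _ _ _ f hf hfB hfR),
    integral_prod _ (hint _ _ _ (fun p => f (p.1, ε * p.2))
      (hf.comp (measurable_fst.prodMk (measurable_snd.const_mul ε)))
      (fun p => hfB _) (fun p hp => hfR _ hp))]
  congr 1
  ext x
  have hsc := Measure.integral_comp_mul_left
    (fun s => (Ioo ε (2 * ε)).indicator (fun _ => (1 : ℝ)) s * f (x, s)) ε
  rw [abs_of_pos (inv_pos.2 hε)] at hsc
  have h1 : ∀ s, (Ioo ε (2 * ε)).indicator (fun _ => (1 : ℝ)) (ε * s) =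
      (Ioo 1 2).indicator (fun _ => (1 : ℝ)) s := by
    intro s
    have : ε * s ∈ Ioo ε (2 * ε) ↔ s ∈ Ioo (1 : ℝ) 2 := by
      rw [mem_Ioo, mem_Ioo, lt_mul_iff_one_lt_right hε, mul_comm 2 ε, mul_lt_mul_iff_right₀ hε]
    by_cases h : s ∈ Ioo (1 : ℝ) 2
    · rw [indicator_of_mem h, indicator_of_mem (this.2 h)]
    · rw [indicator_of_notMem h, indicator_of_notMem fun hc => h (this.1 hc)]
  simp only [h1] at hsc
  rw [hsc, smul_eq_mul, ← integral_const_mul]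
  congr 1
  ext s
  by_cases h : s ∈ Ioo ε (2 * ε)
  · simp [indicator_of_mem h]
  · simp [indicator_of_notMem h]

/-- The divergence theorem in the region above a Lipschitz graph. -/
theorem setIntegral_divergence_graph (hg : LipschitzWith K g) {W : E3 → E3} {w₀ : E2 → E3} {M : ℝ}
    (hWm : Measurable W) (hWc : HasCompactSupport W) (hWM : ∀ y, ‖W y‖ ≤ M)
    (hW : ContDiffOn ℝ 1 W {y | 0 < ((graphChart Φ hg.continuous).symm y).2})
    (hdiv : IntegrableOn (divergence W) {y | 0 < ((graphChart Φ hg.continuous).symm y).2})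
    (hw₀ : ∀ x, Tendsto (fun s => W (graphChart Φ hg.continuous (x, s))) (𝓝[>] 0) (𝓝 (w₀ x))) :
    ∫ y in {y | 0 < ((graphChart Φ hg.continuous).symm y).2}, divergence W y =
      ∫ x, inner ℝ (w₀ x) (graphNormal Φ g x) := by
  set χ := graphChart Φ hg.continuous with hχ
  have hρ : Continuous fun y => (χ.symm y).2 := by fun_prop
  have hVm : MeasurableSet {y | 0 < (χ.symm y).2} := (isOpen_lt continuous_const hρ).measurableSet
  obtain ⟨R, hR⟩ := hWc.isBounded.subset_closedBall (0 : E3)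
  have hM0 : 0 ≤ M := (norm_nonneg _).trans (hWM 0)
  have hfm : Measurable fun p : E2 × ℝ => inner ℝ (W (χ p)) (graphNormal Φ g p.1) :=
    (hWm.comp χ.continuous.measurable).inner ((measurable_graphNormal Φ).comp measurable_fst)
  have hfB : ∀ p : E2 × ℝ, ‖(inner ℝ (W (χ p)) (graphNormal Φ g p.1) : ℝ)‖ ≤ M * (K + 1) :=
    fun p => (norm_inner_le_norm _ _).trans
      (mul_le_mul (hWM _) (norm_graphNormal_le Φ hg _) (norm_nonneg _) hM0)
  have hfR : ∀ p : E2 × ℝ, R < ‖p.1‖ → (inner ℝ (W (χ p)) (graphNormal Φ g p.1) : ℝ) = 0 := by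
    intro p hp
    have : W (χ p) = 0 := by
      by_contra h
      have := hR (subset_tsupport _ h)
      rw [mem_closedBall_zero_iff] at this
      linarith [norm_fst_le_norm_graphChart Φ hg.continuous p]
    rw [this, inner_zero_left]
  -- The ramps converge pointwise to the indicator of positive height, dominated by the divergence
  -- there.
  have hlim1 : Tendsto (fun ε => ∫ y, ramp ε (χ.symm y).2 * divergence W y) (𝓝[>] (0 : ℝ))
      (𝓝 (∫ y in {y | 0 < (χ.symm y).2}, divergence W y)) := by
    rw [← integral_indicator hVm]
    refine tendsto_integral_filter_of_dominated_convergence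
      (fun y => ‖{y | 0 < (χ.symm y).2}.indicator (divergence W) y‖) ?_ ?_
      ((integrable_indicator_iff hVm).2 hdiv).norm ?_
    · filter_upwards [self_mem_nhdsWithin] with ε hε
      have hrm : Measurable fun y => ramp ε (χ.symm y).2 := by
        obtain ⟨C, hC⟩ := exists_lipschitzWith_ramp ε
        exact (hC.continuous.comp hρ).measurable
      refine (hrm.aestronglyMeasurable.mul
        ((integrable_indicator_iff hVm).2 hdiv).aestronglyMeasurable).congr
        (.of_forall fun y => ?_)
      by_cases hy : 0 < (χ.symm y).2
      · simp [indicator_of_mem (show y ∈ {y | 0 < (χ.symm y).2} from hy)]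
      · simp [ramp_of_le hε ((not_lt.1 hy).trans (le_of_lt hε))]
    · filter_upwards [self_mem_nhdsWithin] with ε hε
      refine .of_forall fun y => ?_
      by_cases hy : 0 < (χ.symm y).2
      · rw [indicator_of_mem (show y ∈ {y | 0 < (χ.symm y).2} from hy), norm_mul,
          Real.norm_of_nonneg (ramp_nonneg _ _)]
        exact mul_le_of_le_one_left (norm_nonneg _) (ramp_le_one _ _)
      · rw [ramp_of_le hε ((not_lt.1 hy).trans (le_of_lt hε)), zero_mul, norm_zero]
        exact norm_nonneg _
    · refine .of_forall fun y => ?_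
      refine tendsto_const_nhds.congr' ?_
      by_cases hy : 0 < (χ.symm y).2
      · filter_upwards [self_mem_nhdsWithin, nhdsWithin_le_nhds (Iio_mem_nhds (half_pos hy))]
          with ε hε hε2
        have hε2 : ε < (χ.symm y).2 / 2 := hε2
        rw [indicator_of_mem (show y ∈ {y | 0 < (χ.symm y).2} from hy), ramp_of_ge hε (by linarith),
          one_mul]
      · filter_upwards [self_mem_nhdsWithin] with ε hε
        rw [indicator_of_notMem (show y ∉ {y | 0 < (χ.symm y).2} from hy),
          ramp_of_le hε ((not_lt.1 hy).trans (le_of_lt hε)), zero_mul]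
  -- At fixed `(x, s)` with `s ∈ (1, 2)` the field at height `ε s` tends to the trace `w₀ x`; the
  -- interval has length 1, so no constant survives.
  have hlim2 : Tendsto (fun ε => ∫ p : E2 × ℝ, (Ioo 1 2).indicator (fun _ => (1 : ℝ)) p.2 *
      inner ℝ (W (χ (p.1, ε * p.2))) (graphNormal Φ g p.1)) (𝓝[>] (0 : ℝ))
      (𝓝 (∫ x, inner ℝ (w₀ x) (graphNormal Φ g x))) := by
    have hval : ∫ x, (inner ℝ (w₀ x) (graphNormal Φ g x) : ℝ) =
        ∫ p : E2 × ℝ, (Ioo 1 2).indicator (fun _ => (1 : ℝ)) p.2 *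
          inner ℝ (w₀ p.1) (graphNormal Φ g p.1) := by
      have h1 : ∫ s : ℝ, (Ioo (1 : ℝ) 2).indicator (fun _ => (1 : ℝ)) s = 1 := by
        rw [integral_indicator measurableSet_Ioo]
        norm_num
      have h2 := integral_prod_mul (μ := (volume : Measure E2)) (ν := (volume : Measure ℝ))
        (fun x => (inner ℝ (w₀ x) (graphNormal Φ g x) : ℝ))
        ((Ioo (1 : ℝ) 2).indicator (fun _ => (1 : ℝ)))
      rw [h1, mul_one] at h2
      rw [← h2, Measure.volume_eq_prod]
      simp only [mul_comm]
    rw [hval]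
    have hfin : volume (Metric.closedBall (0 : E2) R ×ˢ Ioo (1 : ℝ) 2) ≠ ⊤ := by
      rw [Measure.volume_eq_prod, Measure.prod_prod]
      exact ENNReal.mul_ne_top measure_closedBall_lt_top.ne (by simp)
    refine tendsto_integral_filter_of_dominated_convergence
      ((Metric.closedBall (0 : E2) R ×ˢ Ioo (1 : ℝ) 2).indicator fun _ => M * (K + 1)) ?_ ?_
      ((integrable_indicator_iff (Metric.isClosed_closedBall.measurableSet.prod
        measurableSet_Ioo)).2 (integrableOn_const hfin)) ?_
    · refine .of_forall fun ε => Measurable.aestronglyMeasurable ?_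
      exact ((measurable_const.indicator measurableSet_Ioo).comp measurable_snd).mul
        (hfm.comp (measurable_fst.prodMk (measurable_snd.const_mul ε)))
    · refine .of_forall fun ε => .of_forall fun p => ?_
      by_cases hs : p.2 ∈ Ioo (1 : ℝ) 2
      · rw [indicator_of_mem hs, one_mul]
        by_cases hp : ‖p.1‖ ≤ R
        · rw [indicator_of_mem (by exact ⟨by simpa using hp, hs⟩)]
          exact hfB (p.1, ε * p.2)
        · rw [hfR (p.1, ε * p.2) (not_le.1 hp), norm_zero]
          exact indicator_nonneg (fun _ _ => by positivity) _
      · rw [indicator_of_notMem hs, zero_mul, norm_zero]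
        exact indicator_nonneg (fun _ _ => by positivity) _
    · refine .of_forall fun p => ?_
      by_cases hs : p.2 ∈ Ioo (1 : ℝ) 2
      · have hp0 : 0 < p.2 := zero_lt_one.trans hs.1
        have ht : Tendsto (fun ε : ℝ => ε * p.2) (𝓝[>] 0) (𝓝[>] 0) := by
          refine tendsto_nhdsWithin_iff.2 ⟨?_, ?_⟩
          · have hc : Continuous fun ε : ℝ => ε * p.2 := by fun_prop
            simpa using (hc.tendsto 0).mono_left nhdsWithin_le_nhds
          · filter_upwards [self_mem_nhdsWithin] with ε hε using mul_pos hε hp0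
        exact (((hw₀ p.1).comp ht).inner tendsto_const_nhds).const_mul _
      · simp only [indicator_of_notMem hs, zero_mul]
        exact tendsto_const_nhds
  refine tendsto_nhds_unique hlim1 (hlim2.congr' ?_)
  filter_upwards [self_mem_nhdsWithin] with ε hε
  rw [integral_ramp_mul_divergence Φ hg hWc hW hε,
    integral_layer_eq_scaled hfm hε hfB hfR]

end GraphDivergence

/-! ### The divergence theorem on bounded Lipschitz domains -/

section LipschitzDomain

variable {Ω : Set E3}

theorem HasLipschitzBoundary.exists_isGraphDomainOn (h : HasLipschitzBoundary Ω) {x : E3}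
    (hx : x ∈ frontier Ω) : ∃ (Φ : E3 ≃ₗᵢ[ℝ] E3) (K : NNReal) (g : E2 → ℝ) (U : Set E3)
      (hg : LipschitzWith K g), IsOpen U ∧ x ∈ U ∧ IsGraphDomainOn Φ hg.continuous Ω U := by
  obtain ⟨Φ, K, g, U, hg, hU, hxU, hΩU⟩ := h x hx
  refine ⟨Φ, K, g, U, hg, hU, hxU, fun y hy => (hΩU y hy).trans ?_⟩
  rw [graphChart_symm_apply, sub_pos]
  rfl

/-- A Lipschitz domain contains a truncated open cone of slope `K` with vertex at the boundary
point, and a convex set with nonempty interior has unique derivatives at points of its closure. This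
is what makes `curlWithin` meaningful on the boundary. -/
theorem uniqueDiffWithinAt_closure_of_isGraphDomainOn (Φ : E3 ≃ₗᵢ[ℝ] E3) {K : NNReal} {g : E2 → ℝ}
    {U : Set E3} (hg : LipschitzWith K g) (hΩ : IsOpen Ω) (hU : IsOpen U)
    (h : IsGraphDomainOn Φ hg.continuous Ω U) {x : E3} (hxU : x ∈ U) (hx : x ∈ frontier Ω) :
    UniqueDiffWithinAt ℝ (closure Ω) x := by
  have hxr : x ∈ range (graphMap Φ g) :=
    (frontier_inter_eq_of_isGraphDomainOn Φ hg.continuous hΩ hU h ▸ ⟨hx, hxU⟩ :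
      x ∈ range (graphMap Φ g) ∩ U).1
  obtain ⟨x₀, rfl⟩ := hxr
  obtain ⟨r, hr, hrU⟩ := Metric.isOpen_iff.1 hU _ hxU
  let L : E3 →L[ℝ] E2 × ℝ := splitVertical.symm.toContinuousLinearMap ∘L
    Φ.toContinuousLinearEquiv.toContinuousLinearMap
  have hL : ∀ y, L y = splitVertical.symm (Φ y) := fun _ => rfl
  have hLx : L (graphMap Φ g x₀) = (x₀, g x₀) := by rw [hL, graphMap]; simp
  set x := graphMap Φ g x₀ with hxdef
  let C : Set E3 := {y | K * ‖(L (y - x)).1‖ < (L (y - x)).2}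
  have hCo : IsOpen C := isOpen_lt (by fun_prop) (by fun_prop)
  have hCc : Convex ℝ C := by
    rw [convex_iff_forall_pos]
    intro y hy z hz a b ha hb hab
    have e : L (a • y + b • z - x) = a • L (y - x) + b • L (z - x) := by
      rw [← map_smul, ← map_smul, ← map_add]
      congr 1
      have : x = a • x + b • x := by rw [← add_smul, hab, one_smul]
      conv_lhs => rw [this]
      module
    change K * ‖(L (a • y + b • z - x)).1‖ < (L (a • y + b • z - x)).2
    have hy' : K * ‖(L (y - x)).1‖ < (L (y - x)).2 := hy
    have hz' : K * ‖(L (z - x)).1‖ < (L (z - x)).2 := hz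
    rw [e]
    simp only [Prod.fst_add, Prod.snd_add, Prod.smul_fst, Prod.smul_snd, smul_eq_mul]
    have h1 := norm_add_le (a • (L (y - x)).1) (b • (L (z - x)).1)
    rw [norm_smul, norm_smul, Real.norm_of_nonneg ha.le, Real.norm_of_nonneg hb.le] at h1
    have h2 : (K : ℝ) * ‖a • (L (y - x)).1 + b • (L (z - x)).1‖ ≤
        K * (a * ‖(L (y - x)).1‖ + b * ‖(L (z - x)).1‖) :=
      mul_le_mul_of_nonneg_left h1 K.2
    nlinarith [mul_lt_mul_of_pos_left hy' ha, mul_lt_mul_of_pos_left hz' hb]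
  have hsub : C ∩ Metric.ball x r ⊆ Ω := by
    rintro y ⟨hyC, hyr⟩
    rw [h y (hrU hyr), graphChart_symm_apply, ← hL]
    have hyC' : K * ‖(L (y - x)).1‖ < (L (y - x)).2 := hyC
    rw [map_sub, hLx] at hyC'
    have h1 := hg.dist_le_mul (L y).1 x₀
    rw [Real.dist_eq, dist_eq_norm] at h1
    have h2 := le_abs_self (g (L y).1 - g x₀)
    simp only [Prod.fst_sub, Prod.snd_sub] at hyC'
    linarith
  have hxC : x ∈ closure (C ∩ Metric.ball x r) := by
    have hc : Tendsto (fun s : ℝ => x + s • Φ.symm (splitVertical (0, 1))) (𝓝[>] 0) (𝓝 x) := by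
      have : Continuous fun s : ℝ => x + s • Φ.symm (splitVertical (0, 1)) := by fun_prop
      have := (this.tendsto 0).mono_left (nhdsWithin_le_nhds (s := Ioi 0))
      simpa using this
    refine mem_closure_of_tendsto hc ?_
    filter_upwards [hc.eventually (Metric.ball_mem_nhds x hr), self_mem_nhdsWithin] with s hs hs0
    refine ⟨?_, hs⟩
    have hs0 : 0 < s := hs0
    change K * ‖(L (_ - x)).1‖ < (L (_ - x)).2
    rw [add_sub_cancel_left, map_smul, hL]
    simpa using hs0
  have hne : (C ∩ Metric.ball x r).Nonempty := closure_nonempty_iff.1 ⟨x, hxC⟩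
  have hop : IsOpen (C ∩ Metric.ball x r) := hCo.inter Metric.isOpen_ball
  exact (uniqueDiffWithinAt_convex (hCc.inter (convex_ball x r))
    (by rwa [hop.interior_eq]) hxC).mono (hsub.trans subset_closure)

theorem HasLipschitzBoundary.uniqueDiffOn_closure (h : HasLipschitzBoundary Ω) (hΩ : IsOpen Ω) :
    UniqueDiffOn ℝ (closure Ω) := by
  intro x hx
  by_cases hxΩ : x ∈ Ω
  · exact uniqueDiffWithinAt_of_mem_nhds (mem_of_superset (hΩ.mem_nhds hxΩ) subset_closure)
  · have hxf : x ∈ frontier Ω := by rw [hΩ.frontier_eq]; exact ⟨hx, hxΩ⟩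
    obtain ⟨Φ, K, g, U, hg, hU, hxU, hΩU⟩ := h.exists_isGraphDomainOn hxf
    exact uniqueDiffWithinAt_closure_of_isGraphDomainOn Φ hg hΩ hU hΩU hxU hxf

theorem closure_mem_nhds_of_mem (hΩ : IsOpen Ω) {x : E3} (hx : x ∈ Ω) : closure Ω ∈ 𝓝 x :=
  mem_of_superset (hΩ.mem_nhds hx) subset_closure

theorem integrableOn_of_continuousOn_closure (hΩb : Bornology.IsBounded Ω)
    {F : Type*} [NormedAddCommGroup F] {f : E3 → F} (hf : ContinuousOn f (closure Ω)) :
    IntegrableOn f Ω :=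
  (hf.integrableOn_compact hΩb.isCompact_closure).mono_set subset_closure

theorem integrableOn_divergence (hΩ : IsOpen Ω) (hΩb : Bornology.IsBounded Ω)
    (hu : UniqueDiffOn ℝ (closure Ω)) {F : E3 → E3} (hF : ContDiffOn ℝ 1 F (closure Ω)) :
    IntegrableOn (divergence F) Ω := by
  have h1 : ContinuousOn (fun x => ∑ i, fderivWithin ℝ F (closure Ω) x
      (EuclideanSpace.single i 1) i) (closure Ω) := by
    have h := hF.continuousOn_fderivWithin hu le_rfl
    fun_prop
  refine (integrableOn_of_continuousOn_closure hΩb h1).congr_fun (fun x hx => ?_) hΩ.measurableSet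
  simp only [divergence, fderivWithin_of_mem_nhds (closure_mem_nhds_of_mem hΩ hx)]

/-- The divergence theorem for the field `F` on `Ω`, including convergence of the flux. -/
def HasDivergenceTheorem (Ω : Set E3) (F : E3 → E3) : Prop :=
  Integrable (fun x => (inner ℝ (F x) (outerNormal Ω x) : ℝ)) (surfaceMeasure Ω) ∧
    ∫ x in Ω, divergence F x = ∫ x, inner ℝ (F x) (outerNormal Ω x) ∂(surfaceMeasure Ω)

theorem eventually_eq_zero_of_notMem {C : Set E3} (hC : IsCompact C) {F : E3 → E3}
    (hF0 : ∀ y ∉ C, F y = 0) {y : E3} (hy : y ∉ C) : F =ᶠ[𝓝 y] fun _ => 0 := by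
  filter_upwards [hC.isClosed.isOpen_compl.mem_nhds hy] with z hz using hF0 z hz

theorem divergence_eq_zero_of_notMem {C : Set E3} (hC : IsCompact C) {F : E3 → E3}
    (hF0 : ∀ y ∉ C, F y = 0) {y : E3} (hy : y ∉ C) : divergence F y = 0 := by
  rw [divergence_congr (eventually_eq_zero_of_notMem hC hF0 hy)]
  simp [divergence]

theorem hasDivergenceTheorem_of_compact_subset (hΩ : IsOpen Ω) {F : E3 → E3}
    (hF : ContDiffOn ℝ 1 F (closure Ω)) {C : Set E3} (hC : IsCompact C) (hCΩ : C ⊆ Ω)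
    (hF0 : ∀ y ∉ C, F y = 0) : HasDivergenceTheorem Ω F := by
  have hFs : ContDiff ℝ 1 F := by
    rw [contDiff_iff_contDiffAt]
    intro y
    by_cases hy : y ∈ C
    · exact hF.contDiffAt (closure_mem_nhds_of_mem hΩ (hCΩ hy))
    · exact ContDiffAt.congr_of_eventuallyEq contDiffAt_const
        (eventually_eq_zero_of_notMem hC hF0 hy)
  have hFc : HasCompactSupport F := HasCompactSupport.intro hC hF0
  have hfr : ∀ᵐ x ∂surfaceMeasure Ω, (inner ℝ (F x) (outerNormal Ω x) : ℝ) = 0 := by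
    filter_upwards [ae_restrict_mem isClosed_frontier.measurableSet] with x hx
    have : x ∉ C := fun hxC => by
      rw [hΩ.frontier_eq] at hx
      exact hx.2 (hCΩ hxC)
    rw [hF0 x this, inner_zero_left]
  refine ⟨(integrable_zero _ _ _).congr (hfr.mono fun x hx => hx.symm), ?_⟩
  rw [integral_eq_zero_of_ae hfr, setIntegral_eq_integral_of_forall_compl_eq_zero,
    integral_divergence_eq_zero hFs hFc]
  exact fun x hx => divergence_eq_zero_of_notMem hC hF0 fun hxC => hx (hCΩ hxC)

/-- The graph theorem concerns the whole region above the graph, while `Ω` is that region only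
inside `U`. Since `F` vanishes off `C ⊆ U`, cutting it off outside `Ω` makes the two settings agree.
-/
theorem hasDivergenceTheorem_of_isGraphDomainOn (hΩ : IsOpen Ω) (hΩb : Bornology.IsBounded Ω)
    (hu : UniqueDiffOn ℝ (closure Ω)) {F : E3 → E3} (hF : ContDiffOn ℝ 1 F (closure Ω))
    (Φ : E3 ≃ₗᵢ[ℝ] E3) {K : NNReal} {g : E2 → ℝ} {U : Set E3} (hg : LipschitzWith K g)
    (hU : IsOpen U) (h : IsGraphDomainOn Φ hg.continuous Ω U) {C : Set E3} (hC : IsCompact C)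
    (hCU : C ⊆ U) (hF0 : ∀ y ∉ C, F y = 0) : HasDivergenceTheorem Ω F := by
  classical
  set χ := graphChart Φ hg.continuous with hχ
  have hρ : Continuous fun y => (χ.symm y).2 := by fun_prop
  have hVm : MeasurableSet {y | 0 < (χ.symm y).2} := (isOpen_lt continuous_const hρ).measurableSet
  have hfront := frontier_inter_eq_of_isGraphDomainOn Φ hg.continuous hΩ hU h
  set W : E3 → E3 := Ω.indicator F with hWdef
  have hWm : Measurable W := by
    rw [hWdef, ← piecewise_eq_indicator]
    exact (hF.continuousOn.mono subset_closure).measurable_piecewise continuousOn_const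
      hΩ.measurableSet
  have hW0 : ∀ y ∉ C, W y = 0 := fun y hy => by
    by_cases hyΩ : y ∈ Ω
    · rw [hWdef, indicator_of_mem hyΩ, hF0 y hy]
    · rw [hWdef, indicator_of_notMem hyΩ]
  have hWc : HasCompactSupport W := HasCompactSupport.intro hC hW0
  obtain ⟨M, hM⟩ := hΩb.isCompact_closure.exists_bound_of_continuousOn hF.continuousOn
  have hM' : ∀ y ∈ closure Ω, ‖F y‖ ≤ max M 0 := fun y hy => (hM y hy).trans (le_max_left _ _)
  have hWM : ∀ y, ‖W y‖ ≤ max M 0 := fun y => by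
    by_cases hyΩ : y ∈ Ω
    · rw [hWdef, indicator_of_mem hyΩ]
      exact hM' y (subset_closure hyΩ)
    · rw [hWdef, indicator_of_notMem hyΩ, norm_zero]
      exact le_max_right _ _
  have hWF : ∀ y ∈ Ω, W =ᶠ[𝓝 y] F := fun y hy => by
    filter_upwards [hΩ.mem_nhds hy] with z hz using indicator_of_mem hz F
  have hW : ContDiffOn ℝ 1 W {y | 0 < (χ.symm y).2} := by
    intro y hy
    refine ContDiffAt.contDiffWithinAt ?_
    by_cases hyC : y ∈ C
    · have hyΩ : y ∈ Ω := (h y (hCU hyC)).2 hy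
      exact (hF.contDiffAt (closure_mem_nhds_of_mem hΩ hyΩ)).congr_of_eventuallyEq (hWF y hyΩ)
    · exact ContDiffAt.congr_of_eventuallyEq contDiffAt_const
        (eventually_eq_zero_of_notMem hC hW0 hyC)
  have hdivind : {y | 0 < (χ.symm y).2}.indicator (divergence W) = Ω.indicator (divergence F) := by
    ext y
    by_cases hyC : y ∈ C
    · have hiff := h y (hCU hyC)
      by_cases hyΩ : y ∈ Ω
      · rw [indicator_of_mem hyΩ, indicator_of_mem (show y ∈ {y | 0 < (χ.symm y).2} from hiff.1 hyΩ),
          divergence_congr (hWF y hyΩ)]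
      · rw [indicator_of_notMem hyΩ, indicator_of_notMem
          (show y ∉ {y | 0 < (χ.symm y).2} from fun hc => hyΩ (hiff.2 hc))]
    · simp only [indicator, divergence_eq_zero_of_notMem hC hW0 hyC,
        divergence_eq_zero_of_notMem hC hF0 hyC, ite_self]
  have hdiv : IntegrableOn (divergence W) {y | 0 < (χ.symm y).2} := by
    rw [← integrable_indicator_iff hVm, hdivind, integrable_indicator_iff hΩ.measurableSet]
    exact integrableOn_divergence hΩ hΩb hu hF
  have hGcl : ∀ x, graphMap Φ g x ∈ C → graphMap Φ g x ∈ closure Ω := fun x hx =>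
    frontier_subset_closure
      (hfront ▸ ⟨mem_range_self x, hCU hx⟩ : graphMap Φ g x ∈ frontier Ω ∩ U).1
  have hw₀ : ∀ x, Tendsto (fun s => W (χ (x, s))) (𝓝[>] 0) (𝓝 (F (graphMap Φ g x))) := by
    intro x
    have hc : Tendsto (fun s : ℝ => χ (x, s)) (𝓝[>] 0) (𝓝 (graphMap Φ g x)) := by
      have : Continuous fun s : ℝ => χ (x, s) := by fun_prop
      rw [← graphChart_zero Φ hg.continuous]
      exact (this.tendsto 0).mono_left nhdsWithin_le_nhds
    by_cases hx : graphMap Φ g x ∈ C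
    · have hev : ∀ᶠ s in 𝓝[>] (0 : ℝ), χ (x, s) ∈ Ω := by
        filter_upwards [hc.eventually (hU.mem_nhds (hCU hx)), self_mem_nhdsWithin] with s hs hs0
        rw [h _ hs, Homeomorph.symm_apply_apply]
        exact hs0
      have h1 : Tendsto (fun s : ℝ => χ (x, s)) (𝓝[>] 0) (𝓝[closure Ω] (graphMap Φ g x)) :=
        tendsto_nhdsWithin_iff.2 ⟨hc, hev.mono fun s hs => subset_closure hs⟩
      refine (Tendsto.comp (hF.continuousOn _ (hGcl x hx)) h1).congr' ?_
      filter_upwards [hev] with s hs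
      rw [hWdef, indicator_of_mem hs]
      rfl
    · rw [hF0 _ hx]
      refine tendsto_const_nhds.congr' ?_
      filter_upwards [hc.eventually (eventually_eq_zero_of_notMem hC hW0 hx)] with s hs
      exact hs.symm
  have key := setIntegral_divergence_graph Φ hg hWm hWc hWM hW hdiv hw₀
  rw [← hχ, ← integral_indicator hVm, hdivind, integral_indicator hΩ.measurableSet] at key
  have hnormal : ∀ᵐ x : E2, (inner ℝ (F (graphMap Φ g x)) (graphNormal Φ g x) : ℝ) =
      ‖graphNormal Φ g x‖ • inner ℝ (F (graphMap Φ g x)) (outerNormal Ω (graphMap Φ g x)) := by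
    filter_upwards [hg.ae_differentiableAt] with x hx
    by_cases hxC : graphMap Φ g x ∈ C
    · rw [outerNormal_eq (isOuterUnitNormal_graphNormal Φ hg.continuous hU h (hCU hxC) hx),
        real_inner_smul_right, smul_eq_mul, mul_inv_cancel_left₀ (norm_graphNormal_pos Φ x).ne']
    · rw [hF0 _ hxC]
      simp
  have hrm : MeasurableSet (range (graphMap Φ g)) :=
    (measurableEmbedding_graphMap Φ hg).measurableSet_range
  -- The boundary and the graph coincide only inside `U`; elsewhere the integrand is zero.
  have hind : (range (graphMap Φ g)).indicator
      (fun y => (inner ℝ (F y) (outerNormal Ω y) : ℝ)) =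
      (frontier Ω).indicator (fun y => (inner ℝ (F y) (outerNormal Ω y) : ℝ)) := by
    ext y
    by_cases hyC : y ∈ C
    · have : y ∈ frontier Ω ↔ y ∈ range (graphMap Φ g) := by
        have := Set.ext_iff.1 hfront y
        simpa [hCU hyC] using this
      simp only [indicator, this]
    · simp only [indicator, hF0 y hyC, inner_zero_left, ite_self]
  -- Nothing is known about `F` outside `closure Ω`, so measurability of its trace is obtained by
  -- approaching the graph from above through the measurable field `W`.
  have hw₀m : Measurable fun x => F (graphMap Φ g x) := by
    have hseq : Tendsto (fun n : ℕ => 1 / ((n : ℝ) + 1)) atTop (𝓝[>] 0) :=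
      tendsto_nhdsWithin_iff.2 ⟨tendsto_one_div_add_atTop_nhds_zero_nat,
        .of_forall fun n => mem_Ioi.2 Nat.one_div_pos_of_nat⟩
    refine measurable_of_tendsto_metrizable
      (f := fun (n : ℕ) x => W (χ (x, 1 / ((n : ℝ) + 1)))) (fun n => ?_)
      (tendsto_pi_nhds.2 fun x => (hw₀ x).comp hseq)
    exact hWm.comp (χ.continuous.measurable.comp (measurable_id.prodMk measurable_const))
  have hint : Integrable fun x => (inner ℝ (F (graphMap Φ g x)) (graphNormal Φ g x) : ℝ) := by
    obtain ⟨R, hR⟩ := hC.isBounded.subset_closedBall (0 : E3)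
    refine Integrable.mono' (g := (Metric.closedBall (0 : E2) R).indicator
      fun _ => max M 0 * (K + 1)) ((integrable_indicator_iff
      Metric.isClosed_closedBall.measurableSet).2 (integrableOn_const
      measure_closedBall_lt_top.ne)) (hw₀m.inner (measurable_graphNormal Φ)).aestronglyMeasurable
      (.of_forall fun x => ?_)
    by_cases hxC : graphMap Φ g x ∈ C
    · have hxR : x ∈ Metric.closedBall (0 : E2) R := by
        have h1 := hR hxC
        rw [mem_closedBall_zero_iff] at h1 ⊢
        have h2 := norm_fst_le_norm_graphChart Φ hg.continuous (x, 0)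
        rw [graphChart_zero] at h2
        exact h2.trans h1
      rw [indicator_of_mem hxR]
      exact (norm_inner_le_norm _ _).trans (mul_le_mul (hM' _ (hGcl x hxC))
        (norm_graphNormal_le Φ hg x) (norm_nonneg _) (le_max_right _ _))
    · rw [hF0 _ hxC, inner_zero_left, norm_zero]
      exact indicator_nonneg (fun _ _ => by positivity) _
  constructor
  · rw [surfaceMeasure]
    change IntegrableOn _ _ _
    rw [← integrable_indicator_iff isClosed_frontier.measurableSet, ← hind,
      integrable_indicator_iff hrm]
    exact (integrable_restrict_range_graphMap_iff Φ hg _).2 (hint.congr hnormal)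
  · rw [surfaceMeasure, ← integral_indicator isClosed_frontier.measurableSet, ← hind,
      integral_indicator hrm, integral_restrict_range_graphMap Φ hg, ← integral_congr_ae hnormal]
    exact key

theorem HasDivergenceTheorem.of_sum (hΩ : IsOpen Ω) (hΩb : Bornology.IsBounded Ω)
    (hu : UniqueDiffOn ℝ (closure Ω)) {ι : Type*} [Fintype ι] {F : E3 → E3} {G : ι → E3 → E3}
    (hG : ∀ i, ContDiffOn ℝ 1 (G i) (closure Ω)) (hGd : ∀ i, HasDivergenceTheorem Ω (G i))
    (hFG : ∀ x ∈ closure Ω, F x = ∑ i, G i x) : HasDivergenceTheorem Ω F := by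
  have h1 : ∀ᵐ x ∂surfaceMeasure Ω, ∑ i, (inner ℝ (G i x) (outerNormal Ω x) : ℝ) =
      inner ℝ (F x) (outerNormal Ω x) := by
    filter_upwards [ae_restrict_mem isClosed_frontier.measurableSet] with x hx
    rw [hFG x (frontier_subset_closure hx), sum_inner]
  have h2 : ∀ x ∈ Ω, divergence F x = ∑ i, divergence (G i) x := by
    intro x hx
    have hd : ∀ i, DifferentiableAt ℝ (G i) x := fun i =>
      ((hG i).contDiffAt (closure_mem_nhds_of_mem hΩ hx)).differentiableAt one_ne_zero
    have he : F =ᶠ[𝓝 x] fun y => ∑ i, G i y := by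
      filter_upwards [hΩ.mem_nhds hx] with y hy using hFG y (subset_closure hy)
    rw [divergence_congr he]
    simp only [divergence]
    rw [fderiv_fun_sum fun i _ => hd i, Finset.sum_comm]
    simp
  refine ⟨(integrable_finsetSum _ fun i _ => (hGd i).1).congr h1, ?_⟩
  rw [← integral_congr_ae h1, integral_finsetSum _ fun i _ => (hGd i).1,
    setIntegral_congr_fun hΩ.measurableSet h2,
    integral_finsetSum _ fun i _ => integrableOn_divergence hΩ hΩb hu (hG i)]
  exact Finset.sum_congr rfl fun i _ => (hGd i).2

/-- **Divergence theorem** on bounded Lipschitz domains. -/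
theorem HasLipschitzBoundary.hasDivergenceTheorem (hΩ : IsOpen Ω) (hΩb : Bornology.IsBounded Ω)
    (hΩL : HasLipschitzBoundary Ω) {F : E3 → E3} (hF : ContDiffOn ℝ 1 F (closure Ω)) :
    HasDivergenceTheorem Ω F := by
  have hu := hΩL.uniqueDiffOn_closure hΩ
  have hloc : ∀ x ∈ closure Ω, ∃ U : Set E3, IsOpen U ∧ x ∈ U ∧ ∀ G : E3 → E3,
      ContDiffOn ℝ 1 G (closure Ω) → ∀ C : Set E3, IsCompact C → C ⊆ U → (∀ y ∉ C, G y = 0) →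
      HasDivergenceTheorem Ω G := by
    intro x hx
    by_cases hxΩ : x ∈ Ω
    · exact ⟨Ω, hΩ, hxΩ, fun G hG C hC hCΩ hG0 =>
        hasDivergenceTheorem_of_compact_subset hΩ hG hC hCΩ hG0⟩
    · have hxf : x ∈ frontier Ω := by rw [hΩ.frontier_eq]; exact ⟨hx, hxΩ⟩
      obtain ⟨Φ, K, g, U, hg, hU, hxU, hΩU⟩ := hΩL.exists_isGraphDomainOn hxf
      exact ⟨U, hU, hxU, fun G hG C hC hCU hG0 =>
        hasDivergenceTheorem_of_isGraphDomainOn hΩ hΩb hu hG Φ hg hU hΩU hC hCU hG0⟩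
  choose! U hUo hxU hUd using hloc
  obtain ⟨t, htΩ, htc⟩ := hΩb.isCompact_closure.elim_nhds_subcover
    -- The unit balls only serve to make the supports of the partition functions bounded, hence
    -- compact.
    (fun x => U x ∩ Metric.ball x 1)
    fun x hx => ((hUo x hx).inter Metric.isOpen_ball).mem_nhds
      ⟨hxU x hx, Metric.mem_ball_self one_pos⟩
  obtain ⟨f, hf⟩ := SmoothPartitionOfUnity.exists_isSubordinate (modelWithCornersSelf ℝ E3)
    (isClosed_closure (s := Ω)) (fun i : t => U i ∩ Metric.ball (i : E3) 1)
    (fun i => (hUo i (htΩ i i.2)).inter Metric.isOpen_ball)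
    (fun x hx => by
      obtain ⟨i, hi, hxi⟩ := mem_iUnion₂.1 (htc hx)
      exact mem_iUnion.2 ⟨⟨i, hi⟩, hxi⟩)
  have hfs : ∀ i, ContDiff ℝ 1 (f i) := fun i =>
    (contMDiff_iff_contDiff.1 (f i).contMDiff).of_le (by simp)
  have hG : ∀ i, ContDiffOn ℝ 1 (fun y => f i y • F y) (closure Ω) := fun i =>
    (hfs i).contDiffOn.smul hF
  refine HasDivergenceTheorem.of_sum hΩ hΩb hu hG (fun i => ?_) fun x hx => ?_
  · have hC : IsCompact (tsupport (f i)) := Metric.isCompact_of_isClosed_isBounded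
      (isClosed_tsupport _) (Metric.isBounded_ball.subset ((hf i).trans inter_subset_right))
    refine hUd i (htΩ i i.2) _ (hG i) _ hC ((hf i).trans inter_subset_left) fun y hy => ?_
    rw [image_eq_zero_of_notMem_tsupport hy, zero_smul]
  · have h1 := f.sum_eq_one hx
    rw [finsum_eq_sum_of_fintype] at h1
    rw [← Finset.sum_smul, h1, one_smul]

end LipschitzDomain

/-! ### Vector calculus -/

section VectorCalculus

/-- The curl as a linear function of the differential. -/
noncomputable def curlCLM : (E3 →L[ℝ] E3) →L[ℝ] E3 :=
  LinearMap.toContinuousLinearMap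
    { toFun := fun B => !₂[B (EuclideanSpace.single 1 1) 2 - B (EuclideanSpace.single 2 1) 1,
        B (EuclideanSpace.single 2 1) 0 - B (EuclideanSpace.single 0 1) 2,
        B (EuclideanSpace.single 0 1) 1 - B (EuclideanSpace.single 1 1) 0]
      map_add' := fun B B' => by ext i; fin_cases i <;> simp <;> ring
      map_smul' := fun c B => by ext i; fin_cases i <;> simp <;> ring }

theorem curlCLM_apply (B : E3 →L[ℝ] E3) :
    curlCLM B = !₂[B (EuclideanSpace.single 1 1) 2 - B (EuclideanSpace.single 2 1) 1,
        B (EuclideanSpace.single 2 1) 0 - B (EuclideanSpace.single 0 1) 2,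
        B (EuclideanSpace.single 0 1) 1 - B (EuclideanSpace.single 1 1) 0] := rfl

/-- Factoring the curl through a continuous linear map transfers the regularity of the differential
to the curl and lets time derivatives pass through. -/
theorem curlWithin_eq (s : Set E3) (F : E3 → E3) (x : E3) :
    curlWithin s F x = curlCLM (fderivWithin ℝ F s x) := rfl

theorem inner_cross3_cyclic (u v w : E3) :
    inner ℝ (cross3 u v) w = inner ℝ (cross3 v w) u := by
  simp only [cross3, PiLp.inner_apply, Fin.sum_univ_three]
  simp
  ring

theorem contDiffOn_cross3 {F G : E3 → E3} {s : Set E3} {n : WithTop ℕ∞} (hF : ContDiffOn ℝ n F s)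
    (hG : ContDiffOn ℝ n G s) : ContDiffOn ℝ n (fun y => cross3 (F y) (G y)) s := by
  rw [contDiffOn_euclidean] at hF hG ⊢
  intro i
  fin_cases i
  · exact ((hF 1).mul (hG 2)).sub ((hF 2).mul (hG 1))
  · exact ((hF 2).mul (hG 0)).sub ((hF 0).mul (hG 2))
  · exact ((hF 0).mul (hG 1)).sub ((hF 1).mul (hG 0))

theorem differentiableAt_coord {w : E3 → E3} {y : E3} (hw : DifferentiableAt ℝ w y) (i : Fin 3) :
    DifferentiableAt ℝ (fun y => w y i) y :=
  differentiableAt_euclidean.1 hw i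

theorem divergence_cross3 {F G : E3 → E3} {x : E3} (hF : DifferentiableAt ℝ F x)
    (hG : DifferentiableAt ℝ G x) :
    divergence (fun y => cross3 (F y) (G y)) x =
      inner ℝ (G x) (curlCLM (fderiv ℝ F x)) - inner ℝ (F x) (curlCLM (fderiv ℝ G x)) := by
  have hF' := differentiableAt_coord hF
  have hG' := differentiableAt_coord hG
  have h : DifferentiableAt ℝ (fun y => cross3 (F y) (G y)) x := by
    rw [differentiableAt_euclidean]
    intro i
    fin_cases i
    · exact ((hF' 1).mul (hG' 2)).sub ((hF' 2).mul (hG' 1))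
    · exact ((hF' 2).mul (hG' 0)).sub ((hF' 0).mul (hG' 2))
    · exact ((hF' 0).mul (hG' 1)).sub ((hF' 1).mul (hG' 0))
  have key : ∀ (i j : Fin 3) (v : E3),
      fderiv ℝ (fun y => F y i * G y j - F y j * G y i) x v =
        (F x i * fderiv ℝ G x v j + G x j * fderiv ℝ F x v i) -
        (F x j * fderiv ℝ G x v i + G x i * fderiv ℝ F x v j) := by
    intro i j v
    rw [fderiv_fun_sub ((hF' i).fun_mul (hG' j)) ((hF' j).fun_mul (hG' i)),
      fderiv_fun_mul (hF' i) (hG' j), fderiv_fun_mul (hF' j) (hG' i)]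
    simp only [FunLike.coe_sub, FunLike.coe_add, FunLike.coe_smul, Pi.sub_apply, Pi.add_apply,
      Pi.smul_apply, fderiv_coord hF, fderiv_coord hG, smul_eq_mul]
  have e0 := key 1 2 (EuclideanSpace.single 0 1)
  have e1 := key 2 0 (EuclideanSpace.single 1 1)
  have e2 := key 0 1 (EuclideanSpace.single 2 1)
  simp only [divergence, ← fderiv_coord h, Fin.sum_univ_three]
  change fderiv ℝ (fun y => F y 1 * G y 2 - F y 2 * G y 1) x _ +
    fderiv ℝ (fun y => F y 2 * G y 0 - F y 0 * G y 2) x _ +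
    fderiv ℝ (fun y => F y 0 * G y 1 - F y 1 * G y 0) x _ = _
  rw [e0, e1, e2]
  simp only [curlCLM_apply, PiLp.inner_apply, Fin.sum_univ_three]
  simp
  ring

end VectorCalculus

/-! ### Uniqueness of the variational derivative -/

section VariationalDerivative

variable {Ω : Set E3}

theorem integrableOn_inner_smul_const {f : E3 → E3} (hf : LocallyIntegrableOn f Ω) {ψ : E3 → ℝ}
    (hψ : Continuous ψ) (hψc : HasCompactSupport ψ) (hψΩ : tsupport ψ ⊆ Ω) (v : E3) :
    Integrable fun x => (inner ℝ (f x) (ψ x • v) : ℝ) := by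
  have h1 : IntegrableOn f (tsupport ψ) := hf.integrableOn_compact_subset hψΩ hψc
  have h2 : IntegrableOn (fun x => (inner ℝ (f x) (ψ x • v) : ℝ)) (tsupport ψ) := by
    have h3 : IntegrableOn (fun x => ψ x * (inner ℝ (f x) v : ℝ)) (tsupport ψ) :=
      IntegrableOn.continuousOn_mul hψ.continuousOn (Integrable.inner_const h1 v) hψc
    refine h3.congr_fun (fun x _ => ?_) (isClosed_tsupport ψ).measurableSet
    simp only [real_inner_smul_right]
  rwa [integrableOn_iff_integrable_of_support_subset] at h2
  intro x hx
  by_contra h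
  exact hx (by simp [image_eq_zero_of_notMem_tsupport h])

/-- A continuous field representing the first variation is the variational derivative a.e. -/
theorem IsVariationalDerivative.ae_eq (hΩ : IsOpen Ω) {𝓕 : (E3 → E3) → ℝ} {u g G : E3 → E3}
    (hg : IsVariationalDerivative Ω 𝓕 u g) (hG : ContinuousOn G Ω)
    (h : ∀ φ : E3 → E3, ContDiff ℝ ∞ φ → HasCompactSupport φ → tsupport φ ⊆ Ω →
      HasDerivAt (fun h : ℝ => 𝓕 (u + h • φ)) (∫ x in Ω, inner ℝ (G x) (φ x)) 0) :
    ∀ᵐ x ∂(volume.restrict Ω), g x = G x := by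
  have hGl : LocallyIntegrableOn G Ω := hG.locallyIntegrableOn hΩ.measurableSet
  have hcomp : ∀ i : Fin 3, ∀ᵐ x, x ∈ Ω → (g x - G x) i = 0 := by
    intro i
    have hL : LocallyIntegrableOn (fun x => (g x - G x) i) Ω := by
      intro x hx
      obtain ⟨s, hs, hi⟩ := (hg.1.sub hGl) x hx
      exact ⟨s, hs, (EuclideanSpace.proj (𝕜 := ℝ) i : E3 →L[ℝ] ℝ).integrable_comp hi⟩
    refine hΩ.ae_eq_zero_of_integral_contDiff_smul_eq_zero hL fun ψ hψ hψc hψΩ => ?_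
    -- Test fields `ψ eᵢ` isolate one component and reduce the claim to the scalar fundamental lemma
    -- of the calculus of variations.
    set v : E3 := EuclideanSpace.single i 1 with hv
    have hsupp : tsupport (fun x => ψ x • v) ⊆ tsupport ψ := by
      refine closure_mono fun x hx hx0 => hx ?_
      simp [hx0]
    have hc : HasCompactSupport fun x => ψ x • v := hψc.of_isClosed_subset
      (isClosed_tsupport _) hsupp
    have hφ : ContDiff ℝ ∞ fun x => ψ x • v := hψ.smul contDiff_const
    have heq := (hg.2 _ hφ hc (hsupp.trans hψΩ)).unique (h _ hφ hc (hsupp.trans hψΩ))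
    have hz : ∀ f : E3 → E3, ∀ x ∉ Ω, (inner ℝ (f x) (ψ x • v) : ℝ) = 0 := fun f x hx => by
      rw [image_eq_zero_of_notMem_tsupport fun hc => hx (hψΩ hc), zero_smul, inner_zero_right]
    rw [setIntegral_eq_integral_of_forall_compl_eq_zero (hz g),
      setIntegral_eq_integral_of_forall_compl_eq_zero (hz G)] at heq
    have hI := integral_sub (integrableOn_inner_smul_const hg.1 hψ.continuous hψc hψΩ v)
      (integrableOn_inner_smul_const hGl hψ.continuous hψc hψΩ v)
    rw [heq, sub_self] at hI
    rw [← hI]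
    congr 1
    ext x
    rw [← inner_sub_left, real_inner_smul_right, hv, EuclideanSpace.inner_single_right]
    simp
  rw [ae_restrict_iff' hΩ.measurableSet]
  filter_upwards [hcomp 0, hcomp 1, hcomp 2] with x h0 h1 h2 hx
  rw [← sub_eq_zero]
  ext i
  fin_cases i
  exacts [h0 hx, h1 hx, h2 hx]

end VariationalDerivative

/-! ### The curl up to the boundary -/

section CurlOnClosure

variable {Ω : Set E3}

theorem continuousOn_curlWithin (hu : UniqueDiffOn ℝ (closure Ω)) {F : E3 → E3}
    (hF : ContDiffOn ℝ 1 F (closure Ω)) :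
    ContinuousOn (curlWithin (closure Ω) F) (closure Ω) :=
  curlCLM.continuous.comp_continuousOn (hF.continuousOn_fderivWithin hu le_rfl)

theorem contDiffOn_curlWithin (hu : UniqueDiffOn ℝ (closure Ω)) {F : E3 → E3}
    (hF : ContDiffOn ℝ 2 F (closure Ω)) :
    ContDiffOn ℝ 1 (curlWithin (closure Ω) F) (closure Ω) :=
  curlCLM.contDiff.comp_contDiffOn (hF.fderivWithin hu (by norm_num))

theorem curlWithin_closure_of_mem (hΩ : IsOpen Ω) (F : E3 → E3) {x : E3} (hx : x ∈ Ω) :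
    curlWithin (closure Ω) F x = curlCLM (fderiv ℝ F x) := by
  rw [curlWithin_eq, fderivWithin_of_mem_nhds (closure_mem_nhds_of_mem hΩ hx)]

theorem curlWithin_add_smul (hu : UniqueDiffOn ℝ (closure Ω)) {F φ : E3 → E3} {x : E3}
    (hx : x ∈ closure Ω) (hF : DifferentiableWithinAt ℝ F (closure Ω) x)
    (hφ : DifferentiableWithinAt ℝ φ (closure Ω) x) (h : ℝ) :
    curlWithin (closure Ω) (F + h • φ) x =
      curlWithin (closure Ω) F x + h • curlWithin (closure Ω) φ x := by
  rw [curlWithin_eq, fderivWithin_add (hu x hx) hF (hφ.const_smul h), map_add,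
    fderivWithin_const_smul (hu x hx) hφ, map_smul]
  rfl

/-- Integration by parts for the curl against a test field. -/
theorem setIntegral_inner_curlWithin (hΩ : IsOpen Ω) (hΩb : Bornology.IsBounded Ω)
    (hu : UniqueDiffOn ℝ (closure Ω)) {F φ : E3 → E3} (hF : ContDiffOn ℝ 1 F (closure Ω))
    (hφ : ContDiff ℝ 1 φ) (hφc : HasCompactSupport φ) (hφΩ : tsupport φ ⊆ Ω) :
    ∫ x in Ω, (inner ℝ (F x) (curlWithin (closure Ω) φ x) : ℝ) =
      ∫ x in Ω, inner ℝ (curlWithin (closure Ω) F x) (φ x) := by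
  have hc := contDiffOn_cross3 hφ.contDiffOn hF
  have h0 : ∀ y ∉ tsupport φ, cross3 (φ y) (F y) = 0 := fun y hy => by
    rw [image_eq_zero_of_notMem_tsupport hy, cross3]
    ext i
    fin_cases i <;> simp
  have hfr : ∀ᵐ x ∂surfaceMeasure Ω,
      (inner ℝ (cross3 (φ x) (F x)) (outerNormal Ω x) : ℝ) = 0 := by
    filter_upwards [ae_restrict_mem isClosed_frontier.measurableSet] with x hx
    rw [hΩ.frontier_eq] at hx
    rw [h0 x fun hxC => hx.2 (hφΩ hxC), inner_zero_left]
  -- The field `φ × F` is supported inside `Ω`, so its flux vanishes and the elementary interior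
  -- case suffices.
  have hdiv := (hasDivergenceTheorem_of_compact_subset hΩ hc hφc hφΩ h0).2
  rw [integral_eq_zero_of_ae hfr] at hdiv
  have hI : ∀ x ∈ Ω, divergence (fun y => cross3 (φ y) (F y)) x =
      inner ℝ (F x) (curlWithin (closure Ω) φ x) -
        inner ℝ (curlWithin (closure Ω) F x) (φ x) := by
    intro x hx
    rw [divergence_cross3 (hφ.differentiable one_ne_zero x)
      ((hF.contDiffAt (closure_mem_nhds_of_mem hΩ hx)).differentiableAt one_ne_zero),
      curlWithin_closure_of_mem hΩ _ hx, curlWithin_closure_of_mem hΩ _ hx,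
      real_inner_comm (φ x)]
  rw [setIntegral_congr_fun hΩ.measurableSet hI, integral_sub] at hdiv
  · linarith
  · exact integrableOn_of_continuousOn_closure hΩb
      (hF.continuousOn.inner (continuousOn_curlWithin hu hφ.contDiffOn))
  · exact integrableOn_of_continuousOn_closure hΩb
      ((continuousOn_curlWithin hu hF).inner hφ.continuous.continuousOn)

end CurlOnClosure

/-! ### Variational derivatives of the electromagnetic Hamiltonian -/

section Hamiltonian

variable {Ω : Set E3} {ε₀ μ₀ : ℝ}

theorem hasDerivAt_quadratic (a b c : ℝ) :
    HasDerivAt (fun h : ℝ => a + h * b + h ^ 2 * c) b 0 := by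
  have h1 := ((hasDerivAt_const (0 : ℝ) a).add ((hasDerivAt_id (0 : ℝ)).mul_const b)).add
    ((hasDerivAt_pow 2 (0 : ℝ)).mul_const c)
  convert! h1 using 1
  simp

theorem continuousOn_emEnergyDensity (hu : UniqueDiffOn ℝ (closure Ω)) {D A : E3 → E3}
    (hD : ContinuousOn D (closure Ω)) (hA : ContDiffOn ℝ 1 A (closure Ω)) :
    ContinuousOn (emEnergyDensity Ω ε₀ μ₀ D A) (closure Ω) := by
  have h1 := continuousOn_curlWithin hu hA
  unfold emEnergyDensity
  fun_prop

theorem norm_sq_add_smul (u v : E3) (h : ℝ) :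
    ‖u + h • v‖ ^ 2 = ‖u‖ ^ 2 + h * (2 * inner ℝ u v) + h ^ 2 * ‖v‖ ^ 2 := by
  rw [norm_add_sq_real, real_inner_smul_right, norm_smul, mul_pow, Real.norm_eq_abs, sq_abs]
  ring

/-- The first variation of an integral whose density is quadratic in the parameter. -/
theorem hasDerivAt_setIntegral_quadratic (hΩ : IsOpen Ω) (hΩb : Bornology.IsBounded Ω)
    {f : ℝ → E3 → ℝ} {a b c : E3 → ℝ} (ha : ContinuousOn a (closure Ω))
    (hb : ContinuousOn b (closure Ω)) (hc : ContinuousOn c (closure Ω))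
    (hf : ∀ h, ∀ x ∈ Ω, f h x = a x + h * b x + h ^ 2 * c x) :
    HasDerivAt (fun h => ∫ x in Ω, f h x) (∫ x in Ω, b x) 0 := by
  have ia : Integrable a (volume.restrict Ω) := integrableOn_of_continuousOn_closure hΩb ha
  have ib : Integrable b (volume.restrict Ω) := integrableOn_of_continuousOn_closure hΩb hb
  have ic : Integrable c (volume.restrict Ω) := integrableOn_of_continuousOn_closure hΩb hc
  have iab : ∀ h : ℝ, Integrable (fun x => a x + h * b x) (volume.restrict Ω) := fun h =>
    ia.add (ib.const_mul h)
  have he : (fun h => ∫ x in Ω, f h x) =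
      fun h => (∫ x in Ω, a x) + h * (∫ x in Ω, b x) + h ^ 2 * ∫ x in Ω, c x := by
    ext h
    rw [setIntegral_congr_fun hΩ.measurableSet (hf h),
      integral_add (iab h) (ic.const_mul _), integral_add ia (ib.const_mul h),
      integral_const_mul, integral_const_mul]
  rw [he]
  exact hasDerivAt_quadratic _ _ _

/-- Along `D + hφ` the energy density is quadratic in `h`, with linear coefficient `(D/ε₀) · φ`. -/
theorem ae_eq_effort_D (hΩ : IsOpen Ω) (hΩb : Bornology.IsBounded Ω)
    (hu : UniqueDiffOn ℝ (closure Ω)) {D A E : E3 → E3}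
    (hD : ContinuousOn D (closure Ω)) (hA : ContDiffOn ℝ 1 A (closure Ω))
    (hE : IsVariationalDerivative Ω (fun D' => emHamiltonian Ω ε₀ μ₀ D' A) D E) :
    ∀ᵐ x ∂(volume.restrict Ω), E x = (1 / ε₀) • D x := by
  refine hE.ae_eq hΩ ((hD.const_smul (1 / ε₀)).mono subset_closure) fun φ hφ _ _ => ?_
  have hφc : ContinuousOn φ (closure Ω) := hφ.continuous.continuousOn
  refine hasDerivAt_setIntegral_quadratic hΩ hΩb
    (a := emEnergyDensity Ω ε₀ μ₀ D A) (c := fun x => 1 / 2 * (1 / ε₀ * ‖φ x‖ ^ 2))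
    (continuousOn_emEnergyDensity hu hD hA) ((hD.const_smul (1 / ε₀)).inner hφc) (by fun_prop)
    fun h x _ => ?_
  simp only [emEnergyDensity, Pi.add_apply, Pi.smul_apply, norm_sq_add_smul, real_inner_smul_left]
  ring

/-- The linear coefficient is now `B · curl φ` with `B = (1/μ₀) curl A`. Moving the curl onto `B`
costs a second derivative of `A` and no boundary term. -/
theorem ae_eq_effort_A (hΩ : IsOpen Ω) (hΩb : Bornology.IsBounded Ω)
    (hu : UniqueDiffOn ℝ (closure Ω)) {D A eA : E3 → E3}
    (hD : ContinuousOn D (closure Ω)) (hA : ContDiffOn ℝ 2 A (closure Ω))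
    (heA : IsVariationalDerivative Ω (fun A' => emHamiltonian Ω ε₀ μ₀ D A') A eA) :
    ∀ᵐ x ∂(volume.restrict Ω),
      eA x = curlWithin (closure Ω) ((1 / μ₀) • curlWithin (closure Ω) A) x := by
  have hA1 : ContDiffOn ℝ 1 A (closure Ω) := hA.of_le one_le_two
  have hB : ContDiffOn ℝ 1 ((1 / μ₀) • curlWithin (closure Ω) A) (closure Ω) :=
    (contDiffOn_curlWithin hu hA).const_smul (1 / μ₀)
  refine heA.ae_eq hΩ ((continuousOn_curlWithin hu hB).mono subset_closure)
    fun φ hφ hφc hφΩ => ?_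
  have hφ1 : ContDiff ℝ 1 φ := hφ.of_le (by simp)
  have hcφ := continuousOn_curlWithin hu hφ1.contDiffOn
  rw [← setIntegral_inner_curlWithin hΩ hΩb hu hB hφ1 hφc hφΩ]
  refine hasDerivAt_setIntegral_quadratic hΩ hΩb
    (a := emEnergyDensity Ω ε₀ μ₀ D A)
    (c := fun x => 1 / 2 * (1 / μ₀ * ‖curlWithin (closure Ω) φ x‖ ^ 2))
    (continuousOn_emEnergyDensity hu hD hA1) (hB.continuousOn.inner hcφ) (by fun_prop)
    fun h x hx => ?_
  have hx' := subset_closure hx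
  simp only [emEnergyDensity, Pi.smul_apply, real_inner_smul_left]
  rw [curlWithin_add_smul hu hx' (hA1.differentiableOn one_ne_zero x hx')
    (hφ1.differentiable one_ne_zero x).differentiableWithinAt, norm_sq_add_smul]
  ring

end Hamiltonian

/-! ### Fields depending on time -/

section TimeDependent

variable {Ω : Set E3} {I : Set ℝ} {t : ℝ} {x : E3}
  {F : Type*} [NormedAddCommGroup F] [NormedSpace ℝ F]

theorem uniqueDiffOn_prod_closure (hI : IsOpen I) (hu : UniqueDiffOn ℝ (closure Ω)) :
    UniqueDiffOn ℝ (I ×ˢ closure Ω) := hI.uniqueDiffOn.prod hu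

theorem fderivWithin_slice {f : ℝ × E3 → F} (hu : UniqueDiffOn ℝ (closure Ω))
    (hf : DifferentiableOn ℝ f (I ×ˢ closure Ω)) (ht : t ∈ I) (hx : x ∈ closure Ω) :
    fderivWithin ℝ (fun y => f (t, y)) (closure Ω) x =
      fderivWithin ℝ f (I ×ˢ closure Ω) (t, x) ∘L ContinuousLinearMap.inr ℝ ℝ E3 := by
  have h1 := (hf (t, x) ⟨ht, hx⟩).hasFDerivWithinAt
  have h2 : HasFDerivWithinAt (fun y : E3 => (t, y)) (ContinuousLinearMap.inr ℝ ℝ E3) (closure Ω)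
      x := (hasFDerivAt_prodMk_right t x).hasFDerivWithinAt
  exact (HasFDerivWithinAt.comp (g := f) x h1 h2 fun y hy => ⟨ht, hy⟩).fderivWithin (hu x hx)

/-- Openness of `I` upgrades the derivative within the product set to an ordinary time derivative,
even for `x` on the boundary. -/
theorem hasDerivAt_slice {f : ℝ × E3 → F} (hI : IsOpen I)
    (hf : DifferentiableOn ℝ f (I ×ˢ closure Ω)) (ht : t ∈ I) (hx : x ∈ closure Ω) :
    HasDerivAt (fun s => f (s, x)) (fderivWithin ℝ f (I ×ˢ closure Ω) (t, x) (1, 0)) t := by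
  have h1 := (hf (t, x) ⟨ht, hx⟩).hasFDerivWithinAt
  have h2 : HasFDerivWithinAt (fun s : ℝ => (s, x)) (ContinuousLinearMap.inl ℝ ℝ E3) I t :=
    (hasFDerivAt_prodMk_left t x).hasFDerivWithinAt
  have h3 := (HasFDerivWithinAt.comp (g := f) t h1 h2
    fun s hs => (⟨hs, hx⟩ : (s, x) ∈ I ×ˢ closure Ω)).hasFDerivAt
    (hI.mem_nhds ht)
  simpa using! h3.hasDerivAt

theorem ContDiffOn.slice {f : ℝ × E3 → F} {n : WithTop ℕ∞} (hf : ContDiffOn ℝ n f (I ×ˢ closure Ω))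
    (ht : t ∈ I) : ContDiffOn ℝ n (fun y => f (t, y)) (closure Ω) :=
  hf.comp (contDiffOn_const.prodMk contDiffOn_id) fun _ hy => ⟨ht, hy⟩

/-- Differentiation under the integral over a bounded domain. -/
theorem hasDerivAt_setIntegral_slice (hI : IsOpen I) (hΩ : IsOpen Ω)
    (hΩb : Bornology.IsBounded Ω) (hu : UniqueDiffOn ℝ (closure Ω)) {f : ℝ × E3 → ℝ}
    (hf : ContDiffOn ℝ 1 f (I ×ˢ closure Ω)) (ht : t ∈ I) :
    IntegrableOn (fun x => fderivWithin ℝ f (I ×ˢ closure Ω) (t, x) (1, 0)) Ω ∧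
    HasDerivAt (fun s => ∫ x in Ω, f (s, x))
      (∫ x in Ω, fderivWithin ℝ f (I ×ˢ closure Ω) (t, x) (1, 0)) t := by
  have hS := uniqueDiffOn_prod_closure hI hu
  have hc : ContinuousOn (fun p => fderivWithin ℝ f (I ×ˢ closure Ω) p (1, 0)) (I ×ˢ closure Ω) :=
    (hf.continuousOn_fderivWithin hS le_rfl).clm_apply continuousOn_const
  -- A compact time interval times the compact closure supplies a constant dominating bound.
  obtain ⟨r, hr, hrI⟩ := Metric.nhds_basis_closedBall.mem_iff.1 (hI.mem_nhds ht)
  have hK : IsCompact (Metric.closedBall t r ×ˢ closure Ω) :=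
    (isCompact_closedBall t r).prod hΩb.isCompact_closure
  obtain ⟨M, hM⟩ := hK.exists_bound_of_continuousOn
    (hc.mono (prod_mono_left hrI))
  have hmeas : ∀ {h : ℝ × E3 → ℝ}, ContinuousOn h (I ×ˢ closure Ω) → ∀ s ∈ I,
      IntegrableOn (fun x => h (s, x)) Ω := fun hh s hs =>
    integrableOn_of_continuousOn_closure hΩb
      (hh.comp (continuousOn_const.prodMk continuousOn_id) fun _ hy => ⟨hs, hy⟩)
  refine hasDerivAt_integral_of_dominated_loc_of_deriv_le (s := Metric.closedBall t r)
    (F := fun s x => f (s, x)) (bound := fun _ => M)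
    (F' := fun s x => fderivWithin ℝ f (I ×ˢ closure Ω) (s, x) (1, 0))
    (Metric.closedBall_mem_nhds t hr) ?_ (hmeas hf.continuousOn t ht)
    (hmeas hc t ht).aestronglyMeasurable ?_ (integrableOn_const hΩb.measure_lt_top.ne) ?_
  · filter_upwards [hI.mem_nhds ht] with s hs using (hmeas hf.continuousOn s hs).aestronglyMeasurable
  · filter_upwards [ae_restrict_mem hΩ.measurableSet] with x hx s hs
    exact hM (s, x) ⟨hs, subset_closure hx⟩
  · filter_upwards [ae_restrict_mem hΩ.measurableSet] with x hx s hs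
    exact hasDerivAt_slice hI (hf.differentiableOn one_ne_zero) (hrI hs) (subset_closure hx)

theorem contDiffOn_deriv_slice (hI : IsOpen I) (hu : UniqueDiffOn ℝ (closure Ω))
    {A : ℝ → E3 → E3} (hA : ContDiffOn ℝ 2 (fun p : ℝ × E3 => A p.1 p.2) (I ×ˢ closure Ω)) :
    ContDiffOn ℝ 1 (fun p : ℝ × E3 => deriv (fun s => A s p.2) p.1) (I ×ˢ closure Ω) := by
  have hB : ContDiffOn ℝ 1 (fderivWithin ℝ (fun p : ℝ × E3 => A p.1 p.2) (I ×ˢ closure Ω))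
      (I ×ˢ closure Ω) := hA.fderivWithin (uniqueDiffOn_prod_closure hI hu) (by norm_num)
  refine (hB.clm_apply (contDiffOn_const (c := ((1 : ℝ), (0 : E3))))).congr fun p hp => ?_
  exact (hasDerivAt_slice hI (hA.differentiableOn two_ne_zero) hp.1 hp.2).deriv

theorem contDiffOn_curlWithin_slice (hI : IsOpen I) (hu : UniqueDiffOn ℝ (closure Ω))
    {A : ℝ → E3 → E3} (hA : ContDiffOn ℝ 2 (fun p : ℝ × E3 => A p.1 p.2) (I ×ˢ closure Ω)) :
    ContDiffOn ℝ 1 (fun p : ℝ × E3 => curlWithin (closure Ω) (A p.1) p.2) (I ×ˢ closure Ω) := by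
  have hB : ContDiffOn ℝ 1 (fderivWithin ℝ (fun p : ℝ × E3 => A p.1 p.2) (I ×ˢ closure Ω))
      (I ×ˢ closure Ω) := hA.fderivWithin (uniqueDiffOn_prod_closure hI hu) (by norm_num)
  refine (curlCLM.contDiff.comp_contDiffOn
    (hB.clm_comp (contDiffOn_const (c := ContinuousLinearMap.inr ℝ ℝ E3)))).congr fun p hp => ?_
  rw [curlWithin_eq, fderivWithin_slice (f := fun p : ℝ × E3 => A p.1 p.2) hu
    (hA.differentiableOn two_ne_zero) hp.1 hp.2]
  rfl

/-- The time derivative commutes with the curl. -/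
theorem fderivWithin_curlWithin_slice (hI : IsOpen I) (hΩ : IsOpen Ω)
    (hu : UniqueDiffOn ℝ (closure Ω)) {A : ℝ → E3 → E3}
    (hA : ContDiffOn ℝ 2 (fun p : ℝ × E3 => A p.1 p.2) (I ×ˢ closure Ω)) (ht : t ∈ I)
    (hx : x ∈ Ω) :
    fderivWithin ℝ (fun p : ℝ × E3 => curlWithin (closure Ω) (A p.1) p.2) (I ×ˢ closure Ω) (t, x)
      (1, 0) = curlWithin (closure Ω) (fun y => deriv (fun s => A s y) t) x := by
  set S := I ×ˢ closure Ω with hSdef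
  have hS : UniqueDiffOn ℝ S := uniqueDiffOn_prod_closure hI hu
  have hx' := subset_closure hx
  have hp : (t, x) ∈ S := ⟨ht, hx'⟩
  set B := fderivWithin ℝ (fun p : ℝ × E3 => A p.1 p.2) S with hBdef
  have hB : ContDiffOn ℝ 1 B S := hA.fderivWithin hS (by norm_num)
  have hBd := (hB.differentiableOn one_ne_zero (t, x) hp).hasFDerivWithinAt
  -- Symmetry within a set requires the point to lie in the closure of its interior; here `x ∈ Ω`
  -- makes it an interior point.
  have hsymm : ∀ v w, fderivWithin ℝ B S (t, x) v w = fderivWithin ℝ B S (t, x) w v := by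
    refine (hA (t, x) hp).isSymmSndFDerivWithinAt (by simp) hS ?_ hp
    refine subset_closure (mem_interior_iff_mem_nhds.2 ?_)
    exact prod_mem_nhds (hI.mem_nhds ht) (closure_mem_nhds_of_mem hΩ hx)
  have h1 : HasFDerivWithinAt (fun p : ℝ × E3 => curlWithin (closure Ω) (A p.1) p.2)
      (curlCLM ∘L ((ContinuousLinearMap.compL ℝ E3 (ℝ × E3) E3).flip
        (ContinuousLinearMap.inr ℝ ℝ E3) ∘L fderivWithin ℝ B S (t, x))) S (t, x) := by
    have h2 := (curlCLM.comp ((ContinuousLinearMap.compL ℝ E3 (ℝ × E3) E3).flip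
      (ContinuousLinearMap.inr ℝ ℝ E3))).hasFDerivAt.comp_hasFDerivWithinAt (t, x) hBd
    refine HasFDerivWithinAt.congr h2 (fun p hp' => ?_) ?_
    all_goals
      rw [curlWithin_eq, fderivWithin_slice (f := fun p : ℝ × E3 => A p.1 p.2) hu
        (hA.differentiableOn two_ne_zero) (by first | exact hp'.1 | exact ht)
        (by first | exact hp'.2 | exact hx')]
      rfl
  have h3 : HasFDerivWithinAt (fun y => deriv (fun s => A s y) t)
      ((ContinuousLinearMap.apply ℝ E3 ((1 : ℝ), (0 : E3)) ∘L fderivWithin ℝ B S (t, x)) ∘L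
        ContinuousLinearMap.inr ℝ ℝ E3) (closure Ω) x := by
    have h4 := (ContinuousLinearMap.apply ℝ E3 ((1 : ℝ), (0 : E3))).hasFDerivAt.comp_hasFDerivWithinAt
      (t, x) hBd
    have h5 : HasFDerivWithinAt (fun y : E3 => (t, y)) (ContinuousLinearMap.inr ℝ ℝ E3) (closure Ω)
      x := (hasFDerivAt_prodMk_right t x).hasFDerivWithinAt
    have h6 := HasFDerivWithinAt.comp x h4 h5 (fun y hy => (⟨ht, hy⟩ : (t, y) ∈ S))
    refine h6.congr (fun y hy => ?_) ?_
    · exact (hasDerivAt_slice (f := fun p : ℝ × E3 => A p.1 p.2) hI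
        (hA.differentiableOn two_ne_zero) ht hy).deriv
    · exact (hasDerivAt_slice (f := fun p : ℝ × E3 => A p.1 p.2) hI
        (hA.differentiableOn two_ne_zero) ht hx').deriv
  -- Both sides are now curls of the mixed second derivative of `A`, with the time and space
  -- arguments in opposite orders.
  rw [h1.fderivWithin (hS _ hp), curlWithin_eq, h3.fderivWithin (hu x hx')]
  change curlCLM (fderivWithin ℝ B S (t, x) (1, 0) ∘L ContinuousLinearMap.inr ℝ ℝ E3) = _
  congr 1
  ext1 v
  exact hsymm (1, 0) (0, v)

end TimeDependent

/-! ### The power balance -/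

theorem mainTheorem9 (Ω : Set E3) (hΩ : IsOpen Ω) (hΩb : Bornology.IsBounded Ω)
    (hΩL : HasLipschitzBoundary Ω) (ε₀ μ₀ : ℝ) (hε : 0 < ε₀) (hμ : 0 < μ₀)
    (I : Set ℝ) (hI : IsOpen I) (D A J E eA : ℝ → E3 → E3)
    (hsol : IsVectorPotentialSolution Ω ε₀ μ₀ I D A J E eA) (t : ℝ) (ht : t ∈ I) :
    -- all the integrals below converge
    IntegrableOn (emEnergyDensity Ω ε₀ μ₀ (D t) (A t)) Ω volume ∧
    Integrable (fun x => inner ℝ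
      (cross3 (deriv (fun s => A s x) t) ((1 / μ₀) • curlWithin (closure Ω) (A t) x))
      (outerNormal Ω x)) (surfaceMeasure Ω) ∧
    IntegrableOn (fun x => inner ℝ (J t x) (E t x)) Ω volume ∧
    -- the power balance
    HasDerivAt (fun s => emHamiltonian Ω ε₀ μ₀ (D s) (A s))
      ((∫ x, inner ℝ
          (cross3 (deriv (fun s => A s x) t) ((1 / μ₀) • curlWithin (closure Ω) (A t) x))
          (outerNormal Ω x) ∂(surfaceMeasure Ω))
        - ∫ x in Ω, inner ℝ (J t x) (E t x)) t ∧
    -- the boundary term is the pairing of the time derivative of the trace of `A`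
    -- with the effort `(1 / μ₀) curl A × n`
    (∫ x, inner ℝ
        (cross3 (deriv (fun s => A s x) t) ((1 / μ₀) • curlWithin (closure Ω) (A t) x))
        (outerNormal Ω x) ∂(surfaceMeasure Ω))
      = ∫ x, inner ℝ
          (cross3 ((1 / μ₀) • curlWithin (closure Ω) (A t) x) (outerNormal Ω x))
          (deriv (fun s => A s x) t) ∂(surfaceMeasure Ω) := by
  have hu := hΩL.uniqueDiffOn_closure hΩ
  have hA2 := hsol.contDiffOn_A
  have hD1 := hsol.contDiffOn_D
  have hDt : ContDiffOn ℝ 1 (D t) (closure Ω) := ContDiffOn.slice hD1 ht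
  have hAt : ContDiffOn ℝ 2 (A t) (closure Ω) := ContDiffOn.slice hA2 ht
  have hAt1 : ContDiffOn ℝ 1 (A t) (closure Ω) := hAt.of_le one_le_two
  have hdA : ContDiffOn ℝ 1 (fun y => deriv (fun s => A s y) t) (closure Ω) :=
    ContDiffOn.slice (contDiffOn_deriv_slice hI hu hA2) ht
  have hcA := contDiffOn_curlWithin_slice hI hu hA2
  have hB : ContDiffOn ℝ 1 (fun y => (1 / μ₀) • curlWithin (closure Ω) (A t) y) (closure Ω) :=
    (contDiffOn_curlWithin hu hAt).const_smul (1 / μ₀)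
  have hflux := contDiffOn_cross3 hdA hB
  obtain ⟨hfluxI, hfluxE⟩ := hΩL.hasDivergenceTheorem hΩ hΩb hflux
  -- rate of change of the energy density
  have hf : ContDiffOn ℝ 1 (fun p : ℝ × E3 => emEnergyDensity Ω ε₀ μ₀ (D p.1) (A p.1) p.2)
      (I ×ˢ closure Ω) :=
    contDiffOn_const.mul ((contDiffOn_const.mul (hcA.norm_sq ℝ)).add
      (contDiffOn_const.mul (hD1.norm_sq ℝ)))
  obtain ⟨hpowerI, hpower⟩ := hasDerivAt_setIntegral_slice hI hΩ hΩb hu hf ht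
  have hrate : ∀ x ∈ Ω, fderivWithin ℝ
      (fun p : ℝ × E3 => emEnergyDensity Ω ε₀ μ₀ (D p.1) (A p.1) p.2) (I ×ˢ closure Ω) (t, x)
        (1, 0) =
      inner ℝ ((1 / μ₀) • curlWithin (closure Ω) (A t) x)
        (curlWithin (closure Ω) (fun y => deriv (fun s => A s y) t) x) +
      inner ℝ ((1 / ε₀) • D t x) (deriv (fun s => D s x) t) := by
    intro x hx
    have hx' := subset_closure hx
    have h1 := hasDerivAt_slice hI (hcA.differentiableOn one_ne_zero) ht hx'
    rw [fderivWithin_curlWithin_slice hI hΩ hu hA2 ht hx] at h1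
    have h2 := (hasDerivAt_slice hI (hD1.differentiableOn one_ne_zero) ht
      hx').differentiableAt.hasDerivAt
    have h3 := (((h1.norm_sq).const_mul (1 / μ₀)).add ((h2.norm_sq).const_mul (1 / ε₀))).const_mul
      (1 / 2)
    have h4 := hasDerivAt_slice hI (hf.differentiableOn one_ne_zero) ht hx'
    rw [h4.unique h3, real_inner_smul_left, real_inner_smul_left]
    ring
  have hdivx : ∀ x ∈ Ω, divergence (fun y => cross3 (deriv (fun s => A s y) t)
      ((1 / μ₀) • curlWithin (closure Ω) (A t) y)) x =
      inner ℝ ((1 / μ₀) • curlWithin (closure Ω) (A t) x)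
        (curlWithin (closure Ω) (fun y => deriv (fun s => A s y) t) x) -
      inner ℝ (deriv (fun s => A s x) t)
        (curlWithin (closure Ω) ((1 / μ₀) • curlWithin (closure Ω) (A t)) x) := by
    intro x hx
    have hn := closure_mem_nhds_of_mem hΩ hx
    rw [divergence_cross3 ((hdA.contDiffAt hn).differentiableAt one_ne_zero)
      ((hB.contDiffAt hn).differentiableAt one_ne_zero),
      curlWithin_closure_of_mem hΩ (fun y => deriv _ t) hx,
      curlWithin_closure_of_mem hΩ ((1 / μ₀) • _) hx]
    rfl
  -- the local power balance
  have hbal : ∀ᵐ x ∂(volume.restrict Ω), inner ℝ (J t x) (E t x) =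
      divergence (fun y => cross3 (deriv (fun s => A s y) t)
        ((1 / μ₀) • curlWithin (closure Ω) (A t) y)) x -
      fderivWithin ℝ (fun p : ℝ × E3 => emEnergyDensity Ω ε₀ μ₀ (D p.1) (A p.1) p.2)
        (I ×ˢ closure Ω) (t, x) (1, 0) := by
    filter_upwards [ae_restrict_mem hΩ.measurableSet, hsol.deriv_D t ht, hsol.deriv_A t ht,
      ae_eq_effort_D hΩ hΩb hu hDt.continuousOn hAt1 (hsol.effort_D t ht),
      ae_eq_effort_A hΩ hΩb hu hDt.continuousOn hAt (hsol.effort_A t ht)] with x hx h1 h2 h3 h4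
    -- The terms `B · curl a` cancel. With `a = -E` the rest is `E · δ_A H - E · (δ_A H - J)`, which
    -- is `J · E`.
    rw [hrate x hx, hdivx x hx, ← h3, ← h4, h1, h2, inner_sub_right, inner_neg_left,
      real_inner_comm (E t x) (J t x)]
    ring
  -- No regularity of `J` is assumed: integrability of `J · E` is read off from the local balance,
  -- whose other side is integrable.
  have hdivI := integrableOn_divergence hΩ hΩb hu hflux
  refine ⟨integrableOn_of_continuousOn_closure hΩb
      (continuousOn_emEnergyDensity hu hDt.continuousOn hAt1), hfluxI,
    (hdivI.sub hpowerI).congr (hbal.mono fun x hx => hx.symm), ?_, ?_⟩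
  · rw [← hfluxE, integral_congr_ae hbal, integral_sub hdivI hpowerI, sub_sub_cancel]
    exact hpower
  · exact integral_congr_ae (.of_forall fun x => inner_cross3_cyclic _ _ _)
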